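/- Let $T(z)=\sum_{k\ge 1} k^{k-1}\frac{z^k}{k!}$ (convergent for $|z|\le 1/e$) be the tree function. Give the edges of the complete directed graph (all ordered pairs of distinct vertices) or of the complete undirected graph on $n$ vertices i.i.d. random weights that are exponentially distributed with mean $1$. A cycle visits distinct vertices; its length is its number of edges, which is at least $2$ in the directed case and at least $3$ in the undirected case, and its mean weight is the sum of its edge weights divided by its length. The min mean-weight cycle (almost surely unique) is the cycle of smallest mean weight. Directed case. For every fixed $k\ge 2$, $$\lim_{n\to\infty}\Pr[\text{the min mean-weight cycle has length } k]=\lim_{n\to\infty}\Pr\Big[\text{the min mean-weight cycle has length } k \text{ and mean weight} \le \tfrac{1}{en}\Big]=p_k,$$ where $$p_k=\int_0^{1/e}\frac{c^{k-1}k^k}{k!}\,e^{-T(c)+c}\,dc .$$ Undirected case. For every fixed $k\ge 3$, $$\lim_{n\to\infty}\Pr[\text{the min mean-weight cycle has length } k]=\lim_{n\to\infty}\Pr\Big[\text{the min mean-weight cycle has length } k \text{ and mean weight} \le \tfrac{1}{en}\Big]=p'_k,$$ where $$p'_k=\int_0^{1/e}\frac{c^{k-1}k^k}{2\,k!}\,e^{(-T(c)+c+c^2)/2}\,dc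 .$$ Consequently both series converge and $\sum_{k\ge 2}p_k<1$ and $\sum_{k\ge 3}p'_k<1$. -/

import Mathlib

open MeasureTheory ProbabilityTheory Filter Topology

/-- The tree function `T(z) = ∑_{k ≥ 1} k^(k-1) z^k / k!`, with the summation index shifted by one
(the series converges for `|z| ≤ 1/e`). -/
noncomputable def treeFunction (z : ℝ) : ℝ :=
  ∑' j : ℕ, ((j + 1 : ℕ) : ℝ) ^ j * z ^ (j + 1) / ((j + 1).factorial : ℝ)

theorem finRotate_apply_ne {k : ℕ} (hk : 2 ≤ k) (i : Fin k) : finRotate k i ≠ i := by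
  have h : i ∈ (finRotate k).support := by
    rw [support_finRotate_of_le hk]; exact Finset.mem_univ i
  exact Equiv.Perm.mem_support.mp h

/-- The arcs of the complete directed graph on `n` vertices (no loops). -/
abbrev Arc (n : ℕ) : Type := {a : Fin n × Fin n // a.1 ≠ a.2}

/-- The edges of the complete undirected graph on `n` vertices (no loops). -/
abbrev UEdge (n : ℕ) : Type := {e : Sym2 (Fin n) // ¬ e.IsDiag}

/-- The law of i.i.d. edge weights, exponential with mean `1`, on a finite set of edges. -/
noncomputable def expWeights (E : Type) [Fintype E] : Measure (E → ℝ) :=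
  Measure.pi fun _ => expMeasure 1

/-- A cycle of the complete directed graph on `n` vertices, given by the cyclic sequence of its
distinct vertices `v₀ → v₁ → ⋯ → v_{k-1} → v₀`, where `k ≥ 2`. (The choice of the starting
vertex affects neither the length nor the weight.) -/
structure DirCycle (n : ℕ) where
  length : ℕ
  two_le : 2 ≤ length
  vert : Fin length ↪ Fin n

namespace DirCycle

variable {n : ℕ}

/-- The `i`-th arc, from a vertex to the cyclically next one. -/
def arc (C : DirCycle n) (i : Fin C.length) : Arc n :=
  ⟨(C.vert i, C.vert (finRotate C.length i)),
    fun h => finRotate_apply_ne C.two_le i (C.vert.injective h).symm⟩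

noncomputable def weight (C : DirCycle n) (w : Arc n → ℝ) : ℝ := ∑ i, w (C.arc i)

noncomputable def meanWeight (C : DirCycle n) (w : Arc n → ℝ) : ℝ := C.weight w / C.length

/-- `C` is a minimum mean-weight cycle. -/
def IsMinMean (C : DirCycle n) (w : Arc n → ℝ) : Prop :=
  ∀ C' : DirCycle n, C.meanWeight w ≤ C'.meanWeight w

end DirCycle

/-- A cycle of the complete undirected graph on `n` vertices, given by the cyclic sequence of its
distinct vertices `v₀, v₁, …, v_{k-1}`, where `k ≥ 3`. (The choice of the starting vertex and of
the orientation affects neither the length nor the weight.) -/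
structure UndirCycle (n : ℕ) where
  length : ℕ
  three_le : 3 ≤ length
  vert : Fin length ↪ Fin n

namespace UndirCycle

variable {n : ℕ}

/-- The `i`-th edge, joining a vertex to the cyclically next one. -/
def edge (C : UndirCycle n) (i : Fin C.length) : UEdge n :=
  ⟨s(C.vert i, C.vert (finRotate C.length i)),
    fun h => finRotate_apply_ne (le_trans (by norm_num) C.three_le) i
      (C.vert.injective (Sym2.mk_isDiag_iff.mp h)).symm⟩

noncomputable def weight (C : UndirCycle n) (w : UEdge n → ℝ) : ℝ := ∑ i, w (C.edge i)

noncomputable def meanWeight (C : UndirCycle n) (w : UEdge n → ℝ) : ℝ := C.weight w / C.length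

/-- `C` is a minimum mean-weight cycle. -/
def IsMinMean (C : UndirCycle n) (w : UEdge n → ℝ) : Prop :=
  ∀ C' : UndirCycle n, C.meanWeight w ≤ C'.meanWeight w

end UndirCycle

/-- The limiting probability of length `k ≥ 2` for the complete directed graph. -/
noncomputable def pDir (k : ℕ) : ℝ :=
  ∫ c in (0 : ℝ)..(1 / Real.exp 1),
    c ^ (k - 1) * (k : ℝ) ^ k / (k.factorial : ℝ) * Real.exp (-treeFunction c + c)

/-- The limiting probability of length `k ≥ 3` for the complete undirected graph. -/
noncomputable def pUndir (k : ℕ) : ℝ :=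
  ∫ c in (0 : ℝ)..(1 / Real.exp 1),
    c ^ (k - 1) * (k : ℝ) ^ k / (2 * (k.factorial : ℝ)) *
      Real.exp ((-treeFunction c + c + c ^ 2) / 2)

/-!
On the scale `1 / n`, the expected number of cycles of length `k` and mean weight at most `c / n`
converges to an intensity proportional to `(k c) ^ k / (k * k!)`. Two distinct cycles that share an
edge span fewer vertices than they have edges, so pairs of overlapping light cycles have vanishing
expected number, and the light cycles of bounded length are asymptotically a Poisson process: with
any threshold `τ k` for each length `k ≤ L`, the probability that no such cycle has mean weight at
most `τ k / n` converges to `exp (-∑ k, intensity k (τ k))`. The probability that the lightest of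
these cycles has length `k` is then a Riemann–Stieltjes sum over the scaled weight `c` of that
cycle.

By Stirling's formula the intensities are summable over `k` at `c = 1 / e`, so long cycles of mean
weight at most `1 / (e n)` can be neglected, whereas for every `c > 1 / e` the sum diverges, so the
minimum is at most `c / n` with probability tending to `1`. Summing the intensities over all lengths
gives the tree function up to its first terms, hence the integrands of `p_k` and `p'_k`. Their sum
over `k` is the total mass `1 - exp (-∑ k, intensity k (1 / e))` of the Poisson minimum below
`1 / e`.
-/

/-! ### Poisson approximation -/

section PoissonApproximation

variable {Ω ι : Type*} [MeasurableSpace Ω]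

/-- `R` is a dependency relation for the events `A`: every `A i` is independent of the
non-occurrence of any finitely many events that are not `R`-related to `i`. -/
def IsDependencyRel (μ : Measure Ω) (A : ι → Set Ω) (R : ι → ι → Prop) : Prop :=
  ∀ (i : ι) (U : Finset ι), (∀ j ∈ U, ¬ R i j) →
    μ.real (A i ∩ ⋂ j ∈ U, (A j)ᶜ) = μ.real (A i) * μ.real (⋂ j ∈ U, (A j)ᶜ)

theorem abs_one_sub_sub_exp_neg_le_sq {p : ℝ} (h0 : 0 ≤ p) (h1 : p ≤ 1) :
    |1 - p - Real.exp (-p)| ≤ p ^ 2 := by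
  have h := Real.abs_exp_sub_one_sub_id_le (x := -p) (by rwa [abs_neg, abs_of_nonneg h0])
  rwa [show Real.exp (-p) - 1 - -p = -(1 - p - Real.exp (-p)) by ring, abs_neg, neg_sq] at h

theorem abs_one_sub_mul_sub_exp_neg_add_le {p P s : ℝ} (h0 : 0 ≤ p) (h1 : p ≤ 1) (hs : 0 ≤ s) :
    |(1 - p) * P - Real.exp (-(p + s))| ≤ |P - Real.exp (-s)| + p ^ 2 := by
  have hsplit : (1 - p) * P - Real.exp (-(p + s)) =
      (1 - p) * (P - Real.exp (-s)) + Real.exp (-s) * (1 - p - Real.exp (-p)) := by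
    rw [neg_add, Real.exp_add]
    ring
  rw [hsplit]
  refine (abs_add_le _ _).trans (add_le_add ?_ ?_)
  · rw [abs_mul, abs_of_nonneg (sub_nonneg.mpr h1)]
    exact mul_le_of_le_one_left (abs_nonneg _) (by linarith)
  · rw [abs_mul, Real.abs_exp]
    exact (mul_le_of_le_one_left (abs_nonneg _) (Real.exp_le_one_iff.mpr (by linarith))).trans
      (abs_one_sub_sub_exp_neg_le_sq h0 h1)

theorem abs_measureReal_sdiff_sdiff_sub_le {μ : Measure Ω} [IsProbabilityMeasure μ]
    {A F U : Set Ω} (hA : MeasurableSet A) (hU : MeasurableSet U)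
    (hind : μ.real (A ∩ F) = μ.real A * μ.real F) :
    |μ.real ((F \ U) \ A) - (1 - μ.real A) * μ.real (F \ U)| ≤
      μ.real (A ∩ U) + μ.real A * μ.real U := by
  have hFU : μ.real (F \ U) + μ.real (F ∩ U) = μ.real F := measureReal_sdiff_add_inter hU
  have hFUA : μ.real ((F \ U) \ A) + μ.real ((A ∩ F) \ U) = μ.real (F \ U) := by
    rw [Set.inter_sdiff_assoc, Set.inter_comm]
    exact measureReal_sdiff_add_inter hA
  have hAFU : μ.real ((A ∩ F) \ U) + μ.real (A ∩ F ∩ U) = μ.real (A ∩ F) :=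
    measureReal_sdiff_add_inter hU
  have hsplit : μ.real ((F \ U) \ A) - (1 - μ.real A) * μ.real (F \ U) =
      μ.real (A ∩ F ∩ U) - μ.real A * μ.real (F ∩ U) := by
    linear_combination hFUA - hAFU - hind + μ.real A * hFU
  rw [hsplit]
  refine (abs_sub _ _).trans (add_le_add ?_ ?_)
  · rw [abs_of_nonneg measureReal_nonneg]
    exact measureReal_mono (Set.inter_subset_inter_left U Set.inter_subset_left)
  · rw [abs_of_nonneg (mul_nonneg measureReal_nonneg measureReal_nonneg)]
    exact mul_le_mul_of_nonneg_left (measureReal_mono Set.inter_subset_right) measureReal_nonneg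

theorem sum_offDiag_add_sum_le_sum_offDiag_insert [DecidableEq ι] {T : Finset ι} {a : ι}
    (ha : a ∉ T) (R : ι → ι → Prop) [DecidableRel R] {f : ι × ι → ℝ} (hf : ∀ p, 0 ≤ f p) :
    ∑ p ∈ T.offDiag with R p.1 p.2, f p + ∑ j ∈ T with R a j, f (a, j) ≤
      ∑ p ∈ (insert a T).offDiag with R p.1 p.2, f p := by
  rw [show ∑ j ∈ T with R a j, f (a, j) =
      ∑ p ∈ (T.filter (R a)).map (Function.Embedding.sectR a ι), f p by
        simp only [Finset.sum_map, Function.Embedding.sectR_apply],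
    ← Finset.sum_union (Finset.disjoint_left.mpr ?_)]
  · refine Finset.sum_le_sum_of_subset_of_nonneg ?_ fun p _ _ => hf p
    rintro ⟨i, j⟩
    simp only [Finset.mem_union, Finset.mem_filter, Finset.mem_offDiag, Finset.mem_map,
      Function.Embedding.sectR_apply, Prod.mk.injEq, Finset.mem_insert]
    grind
  · rintro ⟨i, j⟩
    simp only [Finset.mem_filter, Finset.mem_offDiag, Finset.mem_map,
      Function.Embedding.sectR_apply, Prod.mk.injEq]
    grind

theorem IsDependencyRel.abs_measureReal_iInter_compl_sub_exp_le {μ : Measure Ω}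
    [IsProbabilityMeasure μ] {A : ι → Set Ω} {R : ι → ι → Prop} [DecidableRel R]
    (hR : IsDependencyRel μ A R) (hA : ∀ i, MeasurableSet (A i)) (T : Finset ι) :
    |μ.real (⋂ j ∈ T, (A j)ᶜ) - Real.exp (-∑ j ∈ T, μ.real (A j))| ≤
      ∑ i ∈ T, μ.real (A i) ^ 2 +
      ∑ p ∈ T.offDiag with R p.1 p.2,
        (μ.real (A p.1 ∩ A p.2) + μ.real (A p.1) * μ.real (A p.2)) := by
  classical
  induction T using Finset.induction_on with
  | empty => simp
  | insert a T ha ih =>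
    have hT : (⋂ j ∈ T, (A j)ᶜ) =
        (⋂ j ∈ T.filter (¬ R a ·), (A j)ᶜ) \ ⋃ j ∈ T.filter (R a), A j := by
      ext x
      simp only [Set.mem_iInter, Set.mem_sdiff, Set.mem_iUnion, Set.mem_compl_iff,
        Finset.mem_filter, not_exists]
      grind
    have hinsert : (⋂ j ∈ insert a T, (A j)ᶜ) = (⋂ j ∈ T, (A j)ᶜ) \ A a := by
      rw [Finset.set_biInter_insert, Set.inter_comm, Set.sdiff_eq]
    have hremove : |μ.real (⋂ j ∈ insert a T, (A j)ᶜ) -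
        (1 - μ.real (A a)) * μ.real (⋂ j ∈ T, (A j)ᶜ)| ≤
        ∑ j ∈ T with R a j, (μ.real (A a ∩ A j) + μ.real (A a) * μ.real (A j)) := by
      rw [hinsert, hT]
      refine (abs_measureReal_sdiff_sdiff_sub_le (hA a)
        (Finset.measurableSet_biUnion _ fun j _ => hA j)
        (hR a _ fun j hj => (Finset.mem_filter.mp hj).2)).trans ?_
      rw [Finset.sum_add_distrib, ← Finset.mul_sum, Set.inter_iUnion₂]
      gcongr <;> exact measureReal_biUnion_finset_le _ _
    have hexp := abs_one_sub_mul_sub_exp_neg_add_le (P := μ.real (⋂ j ∈ T, (A j)ᶜ))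
      (measureReal_nonneg (μ := μ) (s := A a)) measureReal_le_one
      (Finset.sum_nonneg fun j (_ : j ∈ T) => measureReal_nonneg (μ := μ) (s := A j))
    have hpairs := sum_offDiag_add_sum_le_sum_offDiag_insert ha R
      (f := fun p => μ.real (A p.1 ∩ A p.2) + μ.real (A p.1) * μ.real (A p.2))
      fun p => by positivity
    have htri := abs_sub_le (μ.real (⋂ j ∈ insert a T, (A j)ᶜ))
      ((1 - μ.real (A a)) * μ.real (⋂ j ∈ T, (A j)ᶜ))
      (Real.exp (-(μ.real (A a) + ∑ j ∈ T, μ.real (A j))))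
    rw [Finset.sum_insert ha, Finset.sum_insert ha]
    linarith

end PoissonApproximation

/-! ### Riemann–Stieltjes sums -/

section RiemannStieltjes

variable {f H h : ℝ → ℝ} {a b δ y : ℝ}

theorem abs_mul_sub_sub_integral_mul_le (hab : a ≤ b)
    (hH : ∀ x ∈ Set.Icc a b, HasDerivAt H (h x) x) (hh : ContinuousOn h (Set.Icc a b))
    (hnn : ∀ x ∈ Set.Icc a b, 0 ≤ h x) (hf : ContinuousOn f (Set.Icc a b))
    (hfy : ∀ x ∈ Set.Icc a b, |y - f x| ≤ δ) :
    |y * (H b - H a) - ∫ x in a..b, f x * h x| ≤ δ * (H b - H a) := by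
  rw [← Set.uIcc_of_le hab] at hH hh hf
  have hint := hh.intervalIntegrable (μ := volume)
  have hfh : IntervalIntegrable (fun x => f x * h x) volume a b :=
    (hf.mul hh).intervalIntegrable
  rw [← intervalIntegral.integral_eq_sub_of_hasDerivAt hH hint,
    ← intervalIntegral.integral_const_mul, ← intervalIntegral.integral_const_mul,
    ← intervalIntegral.integral_sub (hint.const_mul _) hfh]
  refine (intervalIntegral.abs_integral_le_integral_abs hab).trans ?_
  refine intervalIntegral.integral_mono_on hab ((hint.const_mul _).sub hfh).abs
    (hint.const_mul _) fun x hx => ?_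
  rw [← sub_mul, abs_mul, abs_of_nonneg (hnn x hx)]
  exact mul_le_mul_of_nonneg_right (hfy x hx) (hnn x hx)

theorem exists_monotone_partition_abs_sub_le (hab : a ≤ b) (hf : ContinuousOn f (Set.Icc a b))
    (hδ : 0 < δ) :
    ∃ (N : ℕ) (t : ℕ → ℝ), t 0 = a ∧ t N = b ∧ Monotone t ∧
      ∀ i, ∀ x ∈ Set.Icc (t i) (t (i + 1)), ∀ y ∈ Set.Icc (t i) (t (i + 1)),
        |f x - f y| ≤ δ := by
  obtain ⟨t, ht0, htm, ⟨N, hN⟩, ht⟩ := exists_monotone_Icc_subset_open_cover_Icc hab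
    (c := fun z : Set.Icc a b => {x | |f x - f z| < δ / 2})
    (fun z => isOpen_lt ((hf.domRestrict.sub continuous_const).abs) continuous_const)
    fun z _ => Set.mem_iUnion.mpr ⟨z, by simpa using hδ⟩
  refine ⟨N, fun i => t i, ht0, hN N le_rfl, htm, ?_⟩
  intro i x hx y hy
  obtain ⟨z, hz⟩ := ht i
  have hclose : ∀ x ∈ Set.Icc (t i : ℝ) (t (i + 1)), |f x - f z| < δ / 2 := fun x hx =>
    hz (a := ⟨x, (t i).2.1.trans hx.1, hx.2.trans (t (i + 1)).2.2⟩) hx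
  rw [← sub_sub_sub_cancel_right (f x) (f y) (f z)]
  linarith [abs_sub (f x - f z) (f y - f z), hclose x hx, hclose y hy]

/-- The integrator `H` is continuously differentiable, so that the Riemann–Stieltjes integral is
`∫ f H'`; the sums are taken with arbitrary tags `g i`. -/
theorem exists_partition_abs_sum_sub_integral_le (hab : a ≤ b)
    (hH : ∀ x ∈ Set.Icc a b, HasDerivAt H (h x) x) (hh : ContinuousOn h (Set.Icc a b))
    (hnn : ∀ x ∈ Set.Icc a b, 0 ≤ h x) (hf : ContinuousOn f (Set.Icc a b)) {ε : ℝ} (hε : 0 < ε) :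
    ∃ (N : ℕ) (t : ℕ → ℝ), t 0 = a ∧ t N = b ∧ Monotone t ∧
      ∀ g : ℕ → ℝ, (∀ i < N, g i ∈ Set.Icc (t i) (t (i + 1))) →
        |∑ i ∈ Finset.range N, f (g i) * (H (t (i + 1)) - H (t i)) -
          ∫ x in a..b, f x * h x| ≤ ε := by
  have hV : 0 ≤ H b - H a := by
    rw [← intervalIntegral.integral_eq_sub_of_hasDerivAt (by rwa [Set.uIcc_of_le hab])
      (ContinuousOn.intervalIntegrable (by rwa [Set.uIcc_of_le hab]))]
    exact intervalIntegral.integral_nonneg hab hnn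
  have hδ : 0 < ε / (H b - H a + 1) := by positivity
  obtain ⟨N, t, ht0, htN, htm, hosc⟩ := exists_monotone_partition_abs_sub_le hab hf hδ
  refine ⟨N, t, ht0, htN, htm, fun g hg => ?_⟩
  have hsub : ∀ i < N, Set.Icc (t i) (t (i + 1)) ⊆ Set.Icc a b := fun i hi =>
    Set.Icc_subset_Icc (ht0 ▸ htm i.zero_le) (htN ▸ htm hi)
  have hfh : ∀ i < N, IntervalIntegrable (fun x => f x * h x) volume (t i) (t (i + 1)) := by
    intro i hi
    refine ContinuousOn.intervalIntegrable ?_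
    rw [Set.uIcc_of_le (htm i.le_succ)]
    exact (hf.mul hh).mono (hsub i hi)
  rw [← ht0, ← htN, ← intervalIntegral.sum_integral_adjacent_intervals hfh,
    ← Finset.sum_sub_distrib]
  calc _ ≤ ∑ i ∈ Finset.range N, |f (g i) * (H (t (i + 1)) - H (t i)) -
          ∫ x in (t i)..(t (i + 1)), f x * h x| := Finset.abs_sum_le_sum_abs _ _
    _ ≤ ∑ i ∈ Finset.range N, ε / (H b - H a + 1) * (H (t (i + 1)) - H (t i)) := by
        refine Finset.sum_le_sum fun i hi => ?_
        have hi := Finset.mem_range.mp hi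
        exact abs_mul_sub_sub_integral_mul_le (htm i.le_succ)
          (fun x hx => hH x (hsub i hi hx)) (hh.mono (hsub i hi))
          (fun x hx => hnn x (hsub i hi hx)) (hf.mono (hsub i hi))
          fun x hx => hosc i _ (hg i hi) x hx
    _ = ε * ((H b - H a) / (H b - H a + 1)) := by
        rw [← Finset.mul_sum, Finset.sum_range_sub (fun i => H (t i)), ht0, htN]
        ring
    _ ≤ ε := mul_le_of_le_one_right hε.le (div_le_one_of_le₀ (by linarith) (by linarith))

end RiemannStieltjes

/-! ### Exponential edge weights -/

section ExpMeasure

theorem lintegral_expMeasure (r : ℝ) {f : ℝ → ENNReal} (hf : Measurable f) :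
    ∫⁻ t, f t ∂(expMeasure r) =
      ∫⁻ t in Set.Ici 0, ENNReal.ofReal (r * Real.exp (-(r * t))) * f t := by
  have hpdf : Measurable (exponentialPDF r) := (measurable_exponentialPDFReal r).ennreal_ofReal
  have hdensity : expMeasure r = volume.withDensity (exponentialPDF r) := rfl
  rw [hdensity, lintegral_withDensity_eq_lintegral_mul _ hpdf hf,
    ← lintegral_indicator measurableSet_Ici]
  refine lintegral_congr fun t => ?_
  simp only [Pi.mul_apply, Set.indicator_apply, Set.mem_Ici, exponentialPDF_eq]
  split_ifs <;> simp

variable {r : ℝ}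

theorem expMeasure_Iic_le (hr : 0 < r) {x : ℝ} (hx : 0 ≤ x) :
    expMeasure r (Set.Iic x) ≤ ENNReal.ofReal (r * x) := by
  have := isProbabilityMeasure_expMeasure hr
  rw [← ofReal_cdf, cdf_expMeasure_eq hr, if_pos hx]
  exact ENNReal.ofReal_le_ofReal (by linarith [Real.one_sub_le_exp_neg (r * x)])

theorem ae_expMeasure_nonneg (hr : 0 < r) : ∀ᵐ t ∂(expMeasure r), 0 ≤ t := by
  have hzero : expMeasure r (Set.Iic 0) = 0 :=
    le_antisymm (by simpa using expMeasure_Iic_le hr le_rfl) zero_le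
  exact ae_iff.mpr (measure_mono_null (fun t (ht : ¬ 0 ≤ t) => (not_le.mp ht).le) hzero)

end ExpMeasure

theorem lintegral_Icc_ofReal_mul_sub_pow_div_factorial (n : ℕ) {x c : ℝ} (hx : 0 ≤ x)
    (hc : 0 ≤ c) :
    ∫⁻ t in Set.Icc 0 x, ENNReal.ofReal (c * ((x - t) ^ n / n.factorial)) =
      ENNReal.ofReal (c * (x ^ (n + 1) / (n + 1).factorial)) := by
  rw [← ofReal_integral_eq_lintegral_ofReal]
  · congr 1
    rw [integral_Icc_eq_integral_Ioc, ← intervalIntegral.integral_of_le hx,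
      intervalIntegral.integral_const_mul, intervalIntegral.integral_div,
      intervalIntegral.integral_comp_sub_left (fun u => u ^ n) x, integral_pow]
    rw [Nat.factorial_succ]
    push_cast
    field_simp
    simp
  · exact (Continuous.continuousOn (by fun_prop)).integrableOn_compact isCompact_Icc
  · refine (ae_restrict_iff' measurableSet_Icc).mpr (Eventually.of_forall fun t ht => ?_)
    have : 0 ≤ x - t := sub_nonneg.mpr ht.2
    simp only [Pi.zero_apply]
    positivity

/-- The event that the total weight of the edges in `S` is at most `x`. -/
def weightLE {E : Type*} (S : Finset E) (x : ℝ) : Set (E → ℝ) := {w | ∑ e ∈ S, w e ≤ x}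

theorem measurableSet_weightLE {E : Type*} (S : Finset E) (x : ℝ) :
    MeasurableSet (weightLE S x) :=
  measurableSet_le (by fun_prop) measurable_const

namespace expWeights

variable {E : Type} [Fintype E]

instance instIsProbabilityMeasure : IsProbabilityMeasure (expWeights E) :=
  have := isProbabilityMeasure_expMeasure one_pos
  Measure.pi.instIsProbabilityMeasure _

theorem iIndepFun_eval : iIndepFun (fun (e : E) (w : E → ℝ) => w e) (expWeights E) :=
  have := isProbabilityMeasure_expMeasure one_pos
  iIndepFun_pi (X := fun _ => id) fun _ => aemeasurable_id

theorem map_eval (e : E) : (expWeights E).map (fun w => w e) = expMeasure 1 :=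
  have := isProbabilityMeasure_expMeasure one_pos
  (measurePreserving_eval (fun _ : E => expMeasure 1) e).map_eq

theorem ae_nonneg : ∀ᵐ w ∂(expWeights E), ∀ e, 0 ≤ w e :=
  ae_all_iff.mpr fun e => ae_of_ae_map (measurable_pi_apply e).aemeasurable
    (by simpa only [map_eval] using ae_expMeasure_nonneg one_pos)

theorem weightLE_eq_zero_of_neg (S : Finset E) {x : ℝ} (hx : x < 0) :
    expWeights E (weightLE S x) = 0 := by
  rw [measure_eq_zero_iff_ae_notMem]
  filter_upwards [ae_nonneg] with w hw
  exact (hx.trans_le (Finset.sum_nonneg fun e _ => hw e)).not_ge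

theorem measurable_weightLE (S : Finset E) : Measurable fun x => expWeights E (weightLE S x) :=
  Monotone.measurable fun _ _ hxy => measure_mono fun _ hw => le_trans hw hxy

theorem forall_mem_le_le (U : Finset E) {x : ℝ} (hx : 0 ≤ x) :
    expWeights E {w | ∀ e ∈ U, w e ≤ x} ≤ ENNReal.ofReal x ^ U.card := by
  classical
  have := isProbabilityMeasure_expMeasure one_pos
  have hpi : {w : E → ℝ | ∀ e ∈ U, w e ≤ x} = Set.pi Set.univ
      (fun e => if e ∈ U then Set.Iic x else Set.univ) := by
    ext w
    simp only [Set.mem_ofPred_eq, Set.mem_pi, Set.mem_univ, true_implies]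
    refine forall_congr' fun e => ?_
    split_ifs with h <;> simp [h]
  rw [hpi, expWeights, Measure.pi_pi]
  calc _ ≤ ∏ e : E, if e ∈ U then ENNReal.ofReal x else 1 := by
        refine Finset.prod_le_prod' fun e _ => ?_
        split_ifs
        · simpa using expMeasure_Iic_le one_pos hx
        · exact prob_le_one
    _ = _ := by rw [Finset.prod_ite_mem, Finset.univ_inter, Finset.prod_const]

theorem weightLE_insert [DecidableEq E] {S : Finset E} {a : E} (ha : a ∉ S) (x : ℝ) :
    expWeights E (weightLE (insert a S) x) =
      ∫⁻ t, expWeights E (weightLE S (x - t)) ∂(expMeasure 1) := by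
  have hmeas : Measurable fun w : E → ℝ => ∑ e ∈ S, w e := by fun_prop
  have hindep : IndepFun (fun w : E → ℝ => ∑ e ∈ S, w e) (fun w => w a) (expWeights E) := by
    convert iIndepFun_eval.indepFun_finsetSum_of_notMem (fun e => measurable_pi_apply e) ha
      using 1
    ext w
    simp
  have hprod := (indepFun_iff_map_prod_eq_prod_map_map hmeas.aemeasurable
    (measurable_pi_apply a).aemeasurable).mp hindep
  have hset : MeasurableSet {p : ℝ × ℝ | p.1 + p.2 ≤ x} :=
    measurableSet_le (by fun_prop) measurable_const
  have hpre : weightLE (insert a S) x =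
      (fun w => (∑ e ∈ S, w e, w a)) ⁻¹' {p : ℝ × ℝ | p.1 + p.2 ≤ x} := by
    ext w
    simp [weightLE, Finset.sum_insert ha, add_comm]
  have := isProbabilityMeasure_expMeasure one_pos
  rw [hpre, ← Measure.map_apply (hmeas.prodMk (measurable_pi_apply a)) hset, hprod, map_eval,
    Measure.prod_apply_symm hset]
  refine lintegral_congr fun t => ?_
  rw [Measure.map_apply hmeas (measurable_prodMk_right hset)]
  simp [weightLE, le_sub_iff_add_le, Set.preimage]

theorem weightLE_insert_eq_setLIntegral [DecidableEq E] {S : Finset E} {a : E} (ha : a ∉ S)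
    (x : ℝ) :
    expWeights E (weightLE (insert a S) x) =
      ∫⁻ t in Set.Icc 0 x, ENNReal.ofReal (Real.exp (-t)) *
        expWeights E (weightLE S (x - t)) := by
  have hmeas : Measurable fun t => expWeights E (weightLE S (x - t)) :=
    (measurable_weightLE S).comp (measurable_const.sub measurable_id)
  rw [weightLE_insert ha, lintegral_expMeasure 1 hmeas,
    ← lintegral_indicator measurableSet_Ici, ← lintegral_indicator measurableSet_Icc]
  refine lintegral_congr fun t => ?_
  simp only [one_mul, Set.indicator_apply, Set.mem_Ici, Set.mem_Icc]
  rcases le_or_gt t x with htx | hxt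
  · simp only [htx, and_true]
  · simp only [weightLE_eq_zero_of_neg S (sub_neg.mpr hxt), mul_zero, ite_self]

theorem weightLE_le (S : Finset E) {x : ℝ} (hx : 0 ≤ x) :
    expWeights E (weightLE S x) ≤ ENNReal.ofReal (x ^ S.card / S.card.factorial) := by
  classical
  induction S using Finset.induction_on generalizing x with
  | empty => simp [weightLE, hx]
  | insert a S ha ih =>
    rw [weightLE_insert_eq_setLIntegral ha, Finset.card_insert_of_notMem ha, ← one_mul (_ / _),
      ← lintegral_Icc_ofReal_mul_sub_pow_div_factorial _ hx zero_le_one]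
    refine setLIntegral_mono' measurableSet_Icc fun t ht => ?_
    rw [one_mul]
    exact (mul_le_of_le_one_left zero_le (by simpa using ht.1)).trans (ih (sub_nonneg.mpr ht.2))

theorem le_weightLE (S : Finset E) {x : ℝ} (hx : 0 ≤ x) :
    ENNReal.ofReal (Real.exp (-x) * (x ^ S.card / S.card.factorial)) ≤
      expWeights E (weightLE S x) := by
  classical
  induction S using Finset.induction_on generalizing x with
  | empty => simp [weightLE, hx]
  | insert a S ha ih =>
    rw [weightLE_insert_eq_setLIntegral ha, Finset.card_insert_of_notMem ha,
      ← lintegral_Icc_ofReal_mul_sub_pow_div_factorial _ hx (Real.exp_pos _).le]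
    refine setLIntegral_mono' measurableSet_Icc fun t ht => ?_
    rw [show Real.exp (-x) = Real.exp (-t) * Real.exp (-(x - t)) by
      rw [← Real.exp_add]; ring_nf, mul_assoc, ENNReal.ofReal_mul (Real.exp_pos _).le]
    exact mul_le_mul_right (ih (sub_nonneg.mpr ht.2)) _

theorem real_weightLE_le (S : Finset E) {x : ℝ} (hx : 0 ≤ x) :
    (expWeights E).real (weightLE S x) ≤ x ^ S.card / S.card.factorial :=
  ENNReal.toReal_le_of_le_ofReal (by positivity) (weightLE_le S hx)

theorem le_real_weightLE (S : Finset E) {x : ℝ} (hx : 0 ≤ x) :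
    Real.exp (-x) * (x ^ S.card / S.card.factorial) ≤ (expWeights E).real (weightLE S x) :=
  (ENNReal.ofReal_le_iff_le_toReal (measure_ne_top _ _)).mp (le_weightLE S hx)

theorem real_weightLE_inter_weightLE_le [DecidableEq E] (S T : Finset E) {s t x : ℝ}
    (hx : 0 ≤ x) (hs : s ≤ x) (ht : t ≤ x) :
    (expWeights E).real (weightLE S s ∩ weightLE T t) ≤ x ^ (S ∪ T).card := by
  refine ENNReal.toReal_le_of_le_ofReal (by positivity) ?_
  rw [ENNReal.ofReal_pow hx]
  refine (measure_mono_ae ?_).trans (forall_mem_le_le (S ∪ T) hx)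
  filter_upwards [ae_nonneg] with w hw ⟨hwS, hwT⟩ e he
  rcases Finset.mem_union.mp he with he | he
  · exact ((Finset.single_le_sum (fun e _ => hw e) he).trans hwS).trans hs
  · exact ((Finset.single_le_sum (fun e _ => hw e) he).trans hwT).trans ht

theorem isDependencyRel_weightLE (x : Finset E → ℝ) :
    IsDependencyRel (expWeights E) (fun S => weightLE S (x S)) fun S T => ¬ Disjoint S T := by
  classical
  intro S U hU
  have hindep := (iIndepFun_eval (E := E)).indepFun_finset S Sᶜ disjoint_compl_right
    fun e => measurable_pi_apply e
  have hS : weightLE S (x S) =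
      (fun w (e : S) => w e) ⁻¹' {u : S → ℝ | ∑ e : S, u e ≤ x S} := by
    ext w
    simp only [weightLE, Set.mem_ofPred_eq, Set.mem_preimage]
    rw [Finset.sum_coe_sort S (fun e => w e)]
  have hcompl : (⋂ T ∈ U, (weightLE T (x T))ᶜ) =
      (fun w (e : (Sᶜ : Finset E)) => w e) ⁻¹'
        ⋂ T ∈ U, {u : (Sᶜ : Finset E) → ℝ | ∑ e : (Sᶜ : Finset E),
          (if (e : E) ∈ T then u e else 0) ≤ x T}ᶜ := by
    simp only [Set.preimage_iInter]
    refine Set.iInter₂_congr fun T hT => ?_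
    have hTS : T ⊆ Sᶜ :=
      Finset.subset_compl_iff_disjoint_right.mpr (not_not.mp (hU T hT)).symm
    ext w
    simp only [weightLE, Set.mem_ofPred_eq, Set.mem_preimage, Set.mem_compl_iff]
    rw [Finset.sum_coe_sort Sᶜ (fun e => if e ∈ T then w e else 0), Finset.sum_ite_mem,
      Finset.inter_eq_right.mpr hTS]
  beta_reduce
  rw [hS, hcompl, measureReal_def, hindep.measure_inter_preimage_eq_mul, ENNReal.toReal_mul]
  · rfl
  · exact measurableSet_le (by fun_prop) measurable_const
  · refine Finset.measurableSet_biInter _ fun T _ => (measurableSet_le ?_ measurable_const).compl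
    refine Finset.measurable_sum _ fun e _ => ?_
    split_ifs
    · exact measurable_pi_apply e
    · exact measurable_const

end expWeights

/-! ### Cycles and their overlaps -/

theorem card_lt_card_union_image_of_isCycleOn {α : Type*} [DecidableEq α] {σ : Equiv.Perm α}
    {s J : Finset α} (hσ : σ.IsCycleOn s) (hJs : J ⊆ s) (hJ : J.Nonempty) (hne : J ≠ s) :
    J.card < (J ∪ J.image σ).card := by
  refine Finset.card_lt_card ⟨Finset.subset_union_left, fun hsub => hne (hJs.antisymm ?_)⟩
  have hmaps : Set.MapsTo σ J J := fun i hi =>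
    hsub (Finset.mem_union_right _ (Finset.mem_image_of_mem _ hi))
  obtain ⟨i, hi⟩ := hJ
  intro j hj
  obtain ⟨m, -, rfl⟩ := hσ.exists_pow_eq (hJs hi) hj
  exact hmaps.perm_pow m hi

theorem finRotate_isCycleOn_univ {k : ℕ} (hk : 2 ≤ k) :
    (finRotate k).IsCycleOn (Finset.univ : Finset (Fin k)) := by
  convert (isCycle_finRotate_of_le hk).isCycleOn using 1
  rw [Finset.coe_univ]
  exact (Set.eq_univ_of_forall (finRotate_apply_ne hk)).symm

theorem tendsto_descFactorial_div_pow (k : ℕ) :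
    Tendsto (fun n : ℕ => (n.descFactorial k : ℝ) / (n : ℝ) ^ k) atTop (𝓝 1) := by
  refine (Asymptotics.isEquivalent_iff_tendsto_one ?_).mp (isEquivalent_descFactorial k)
  filter_upwards [eventually_ne_atTop 0] with n hn
  positivity

namespace DirCycle

variable {n : ℕ}

/-- The set of edges of a cycle, when every arc determines an edge. -/
def edgeSetOf {E : Type*} [DecidableEq E] (f : Arc n → E) (C : DirCycle n) : Finset E :=
  Finset.univ.image fun i => f (C.arc i)

/-- The set of vertices of a cycle. -/
def verts (C : DirCycle n) : Finset (Fin n) := Finset.univ.map C.vert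

theorem card_verts (C : DirCycle n) : C.verts.card = C.length := by
  rw [verts, Finset.card_map, Finset.card_univ, Fintype.card_fin]

theorem vert_mem_verts (C : DirCycle n) (i : Fin C.length) : C.vert i ∈ C.verts :=
  Finset.mem_map_of_mem _ (Finset.mem_univ i)

theorem length_le (C : DirCycle n) : C.length ≤ n := by
  simpa only [Fintype.card_fin] using Fintype.card_le_of_embedding C.vert

end DirCycle

/-- A common framework for the cycles of complete directed and undirected graphs: arcs determine
edges, cycles have length at least `minLen`, and the edge set of each cycle of length `k` is
represented by `mult * k` sequences of vertices. -/
structure CycleModel where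
  Edge : ℕ → Type
  [fintypeEdge : ∀ n, Fintype (Edge n)]
  [decEqEdge : ∀ n, DecidableEq (Edge n)]
  ofArc : ∀ {n}, Arc n → Edge n
  ends : ∀ {n}, Edge n → Finset (Fin n)
  ends_ofArc : ∀ {n} (a : Arc n), ends (ofArc a) = {a.1.1, a.1.2}
  minLen : ℕ
  two_le_minLen : 2 ≤ minLen
  mult : ℕ
  mult_pos : 0 < mult
  edge_injective : ∀ {n} (C : DirCycle n), minLen ≤ C.length →
    Function.Injective fun i => ofArc (C.arc i)
  card_fiber : ∀ {n} (C : DirCycle n), minLen ≤ C.length →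
    (Finset.univ.filter fun v : Fin C.length ↪ Fin n =>
      (⟨C.length, C.two_le, v⟩ : DirCycle n).edgeSetOf ofArc = C.edgeSetOf ofArc).card =
      mult * C.length

attribute [instance] CycleModel.fintypeEdge CycleModel.decEqEdge

namespace CycleModel

section Definitions

variable (M : CycleModel) {n : ℕ}

/-- The set of edges of a cycle. -/
abbrev edgeSet (C : DirCycle n) : Finset (M.Edge n) := C.edgeSetOf M.ofArc

/-- The set of endpoints of the edges in `S`. -/
def endpoints (S : Finset (M.Edge n)) : Finset (Fin n) := S.biUnion M.ends

/-- The set of edges with both endpoints in `U`. -/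
def edgesIn (U : Finset (Fin n)) : Finset (M.Edge n) :=
  (Finset.univ.filter fun a : Arc n => a.1.1 ∈ U ∧ a.1.2 ∈ U).image M.ofArc

open scoped Classical in
/-- The edge sets of the cycles of length `k`. -/
noncomputable def cycleSets (n k : ℕ) : Finset (Finset (M.Edge n)) :=
  Finset.univ.filter fun S => ∃ C : DirCycle n, C.length = k ∧ M.edgeSet C = S

/-- The edge sets of the cycles of length at most `L`. -/
noncomputable def shortSets (n L : ℕ) : Finset (Finset (M.Edge n)) :=
  (Finset.Icc M.minLen L).biUnion (M.cycleSets n)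

/-- The ordered pairs of distinct short cycles that share an edge. -/
noncomputable def overlappingPairs (n L : ℕ) :
    Finset (Finset (M.Edge n) × Finset (M.Edge n)) :=
  (M.shortSets n L).offDiag.filter fun p => ¬ Disjoint p.1 p.2

end Definitions

variable {M : CycleModel} {n L : ℕ}

section EdgeSets

variable {C C' : DirCycle n}

theorem card_edgeSet (hC : M.minLen ≤ C.length) : (M.edgeSet C).card = C.length := by
  rw [edgeSet, DirCycle.edgeSetOf, Finset.card_image_of_injective _ (M.edge_injective C hC),
    Finset.card_univ, Fintype.card_fin]

theorem ends_ofArc_arc (C : DirCycle n) (i : Fin C.length) :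
    M.ends (M.ofArc (C.arc i)) = {C.vert i, C.vert (finRotate C.length i)} :=
  M.ends_ofArc _

theorem endpoints_edgeSet (C : DirCycle n) : M.endpoints (M.edgeSet C) = C.verts := by
  ext x
  simp only [endpoints, edgeSet, DirCycle.edgeSetOf, Finset.mem_biUnion, Finset.mem_image,
    Finset.mem_univ, true_and, exists_exists_eq_and, ends_ofArc_arc, DirCycle.verts,
    Finset.mem_map, Finset.mem_insert, Finset.mem_singleton]
  constructor
  · rintro ⟨i, rfl | rfl⟩ <;> exact ⟨_, rfl⟩
  · rintro ⟨i, rfl⟩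
    exact ⟨i, Or.inl rfl⟩

theorem endpoints_union (S T : Finset (M.Edge n)) :
    M.endpoints (S ∪ T) = M.endpoints S ∪ M.endpoints T :=
  Finset.union_biUnion

theorem edgeSet_subset_edgesIn {U : Finset (Fin n)} (h : C.verts ⊆ U) :
    M.edgeSet C ⊆ M.edgesIn U := by
  intro e he
  obtain ⟨i, -, rfl⟩ := Finset.mem_image.mp he
  exact Finset.mem_image_of_mem _ (Finset.mem_filter.mpr
    ⟨Finset.mem_univ _, h (C.vert_mem_verts _), h (C.vert_mem_verts _)⟩)

theorem card_edgesIn_le (U : Finset (Fin n)) : (M.edgesIn U).card ≤ U.card ^ 2 := by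
  refine Finset.card_image_le.trans ?_
  rw [sq, ← Finset.card_product]
  refine Finset.card_le_card_of_injOn (fun a => a.1) ?_ Subtype.val_injective.injOn
  intro a ha
  simpa using ha

theorem vert_mem_verts_of_ofArc_mem {i : Fin C.length} (hi : M.ofArc (C.arc i) ∈ M.edgeSet C') :
    C.vert i ∈ C'.verts ∧ C.vert (finRotate C.length i) ∈ C'.verts := by
  have hsub : M.ends (M.ofArc (C.arc i)) ⊆ C'.verts := by
    rw [← endpoints_edgeSet (M := M)]
    exact Finset.subset_biUnion_of_mem _ hi
  rwa [ends_ofArc_arc, Finset.insert_subset_iff, Finset.singleton_subset_iff] at hsub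

theorem card_edgeSet_inter_lt (hC : M.minLen ≤ C.length)
    (hne : (M.edgeSet C ∩ M.edgeSet C').Nonempty) (hns : ¬ M.edgeSet C ⊆ M.edgeSet C') :
    (M.edgeSet C ∩ M.edgeSet C').card < (C.verts ∩ C'.verts).card := by
  let J := Finset.univ.filter fun i => M.ofArc (C.arc i) ∈ M.edgeSet C'
  have hinter : M.edgeSet C ∩ M.edgeSet C' = J.image fun i => M.ofArc (C.arc i) := by
    rw [← Finset.filter_mem_eq_inter]
    exact Finset.filter_image
  have hJ : J.Nonempty := by rwa [hinter, Finset.image_nonempty] at hne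
  have hJuniv : J ≠ Finset.univ := by
    intro h
    refine hns (Finset.inter_eq_left.mp ?_)
    rw [hinter, h, edgeSet, DirCycle.edgeSetOf]
  rw [hinter, Finset.card_image_of_injective _ (M.edge_injective C hC)]
  refine (card_lt_card_union_image_of_isCycleOn (finRotate_isCycleOn_univ C.two_le)
    (Finset.subset_univ J) hJ hJuniv).trans_le ?_
  rw [← Finset.card_map C.vert]
  refine Finset.card_le_card fun x hx => ?_
  obtain ⟨i, hi, rfl⟩ := Finset.mem_map.mp hx
  refine Finset.mem_inter.mpr ⟨C.vert_mem_verts i, ?_⟩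
  rcases Finset.mem_union.mp hi with hi | hi
  · exact (vert_mem_verts_of_ofArc_mem (Finset.mem_filter.mp hi).2).1
  · obtain ⟨j, hj, rfl⟩ := Finset.mem_image.mp hi
    exact (vert_mem_verts_of_ofArc_mem (Finset.mem_filter.mp hj).2).2

/-- The common edges of two cycles form a union of proper subpaths of one of them, which has fewer
edges than vertices. -/
theorem card_endpoints_union_lt (hC : M.minLen ≤ C.length) (hC' : M.minLen ≤ C'.length)
    (hne : M.edgeSet C ≠ M.edgeSet C') (hd : ¬ Disjoint (M.edgeSet C) (M.edgeSet C')) :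
    (M.endpoints (M.edgeSet C ∪ M.edgeSet C')).card < (M.edgeSet C ∪ M.edgeSet C').card := by
  rw [Finset.not_disjoint_iff_nonempty_inter] at hd
  have hlt : (M.edgeSet C ∩ M.edgeSet C').card < (C.verts ∩ C'.verts).card := by
    by_cases hsub : M.edgeSet C ⊆ M.edgeSet C'
    · rw [Finset.inter_comm] at hd
      rw [Finset.inter_comm, Finset.inter_comm C.verts]
      exact card_edgeSet_inter_lt hC' hd fun h => hne (hsub.antisymm h)
    · exact card_edgeSet_inter_lt hC hd hsub
  have hedges := Finset.card_union_add_card_inter (M.edgeSet C) (M.edgeSet C')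
  have hverts := Finset.card_union_add_card_inter C.verts C'.verts
  rw [card_edgeSet hC, card_edgeSet hC'] at hedges
  rw [DirCycle.card_verts, DirCycle.card_verts] at hverts
  rw [endpoints_union, endpoints_edgeSet, endpoints_edgeSet]
  omega

end EdgeSets

section CycleSets

variable {k : ℕ} {S : Finset (M.Edge n)}

theorem mem_cycleSets :
    S ∈ M.cycleSets n k ↔ ∃ C : DirCycle n, C.length = k ∧ M.edgeSet C = S := by
  simp only [cycleSets, Finset.mem_filter, Finset.mem_univ, true_and]

theorem mem_shortSets :
    S ∈ M.shortSets n L ↔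
      ∃ C : DirCycle n, M.minLen ≤ C.length ∧ C.length ≤ L ∧ M.edgeSet C = S := by
  simp only [shortSets, Finset.mem_biUnion, Finset.mem_Icc, mem_cycleSets]
  constructor
  · rintro ⟨k, ⟨hmin, hmax⟩, C, rfl, rfl⟩
    exact ⟨C, hmin, hmax, rfl⟩
  · rintro ⟨C, hmin, hmax, rfl⟩
    exact ⟨C.length, ⟨hmin, hmax⟩, C, rfl, rfl⟩

theorem card_of_mem_cycleSets (hk : M.minLen ≤ k) (hS : S ∈ M.cycleSets n k) : S.card = k := by
  obtain ⟨C, rfl, rfl⟩ := mem_cycleSets.mp hS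
  exact card_edgeSet hk

theorem sum_shortSets (f : Finset (M.Edge n) → ℝ) :
    ∑ S ∈ M.shortSets n L, f S =
      ∑ k ∈ Finset.Icc M.minLen L, ∑ S ∈ M.cycleSets n k, f S := by
  rw [shortSets, Finset.sum_biUnion]
  intro k hk k' hk' hne
  refine Finset.disjoint_left.mpr fun S hS hS' => hne ?_
  rw [← card_of_mem_cycleSets (Finset.mem_Icc.mp hk).1 hS,
    card_of_mem_cycleSets (Finset.mem_Icc.mp hk').1 hS']

theorem mult_mul_card_cycleSets (hk : M.minLen ≤ k) :
    M.mult * k * (M.cycleSets n k).card = n.descFactorial k := by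
  have hk2 : 2 ≤ k := M.two_le_minLen.trans hk
  have hcard := Finset.card_eq_sum_card_fiberwise (s := Finset.univ) (t := M.cycleSets n k)
    (f := fun v : Fin k ↪ Fin n => M.edgeSet ⟨k, hk2, v⟩)
    fun v _ => mem_cycleSets.mpr ⟨_, rfl, rfl⟩
  rw [Finset.card_univ, Fintype.card_embedding_eq, Fintype.card_fin, Fintype.card_fin] at hcard
  rw [hcard, Finset.sum_const_nat (m := M.mult * k), mul_comm]
  intro S hS
  obtain ⟨C, rfl, rfl⟩ := mem_cycleSets.mp hS
  exact M.card_fiber C hk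

theorem card_cycleSets (hk : M.minLen ≤ k) :
    ((M.cycleSets n k).card : ℝ) = n.descFactorial k / (M.mult * k) := by
  have hk0 : 0 < k := two_pos.trans_le (M.two_le_minLen.trans hk)
  have hm0 := M.mult_pos
  rw [eq_div_iff (by positivity), ← mult_mul_card_cycleSets hk]
  push_cast
  ring

end CycleSets

section OverlappingPairs

variable {p : Finset (M.Edge n) × Finset (M.Edge n)}

theorem exists_of_mem_overlappingPairs (hp : p ∈ M.overlappingPairs n L) :
    ∃ C C' : DirCycle n, (M.minLen ≤ C.length ∧ C.length ≤ L) ∧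
      (M.minLen ≤ C'.length ∧ C'.length ≤ L) ∧ p = (M.edgeSet C, M.edgeSet C') ∧
      M.edgeSet C ≠ M.edgeSet C' ∧ ¬ Disjoint (M.edgeSet C) (M.edgeSet C') := by
  obtain ⟨hoff, hdisj⟩ := Finset.mem_filter.mp hp
  obtain ⟨hp1, hp2, hne⟩ := Finset.mem_offDiag.mp hoff
  obtain ⟨C, hmin, hmax, hC⟩ := mem_shortSets.mp hp1
  obtain ⟨C', hmin', hmax', hC'⟩ := mem_shortSets.mp hp2
  refine ⟨C, C', ⟨hmin, hmax⟩, ⟨hmin', hmax'⟩, Prod.ext hC.symm hC'.symm, ?_⟩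
  rw [hC, hC']
  exact ⟨hne, hdisj⟩

theorem card_endpoints_lt_of_mem_overlappingPairs (hp : p ∈ M.overlappingPairs n L) :
    (M.endpoints (p.1 ∪ p.2)).card < (p.1 ∪ p.2).card := by
  obtain ⟨C, C', hC, hC', rfl, hne, hdisj⟩ := exists_of_mem_overlappingPairs hp
  exact card_endpoints_union_lt hC.1 hC'.1 hne hdisj

theorem card_endpoints_le_of_mem_overlappingPairs (hp : p ∈ M.overlappingPairs n L) :
    (M.endpoints (p.1 ∪ p.2)).card ≤ 2 * L := by
  obtain ⟨C, C', ⟨-, hC⟩, ⟨-, hC'⟩, rfl, -⟩ := exists_of_mem_overlappingPairs hp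
  rw [endpoints_union, endpoints_edgeSet, endpoints_edgeSet]
  refine (Finset.card_union_le _ _).trans ?_
  rw [DirCycle.card_verts, DirCycle.card_verts]
  omega

theorem card_overlappingPairs_endpoints_eq_le (U : Finset (Fin n)) :
    ((M.overlappingPairs n L).filter fun p => M.endpoints (p.1 ∪ p.2) = U).card ≤
      2 ^ (2 * U.card ^ 2) := by
  calc _ ≤ ((M.edgesIn U).powerset ×ˢ (M.edgesIn U).powerset).card := by
        refine Finset.card_le_card fun p hp => ?_
        obtain ⟨hp, hU⟩ := Finset.mem_filter.mp hp
        obtain ⟨C, C', -, -, rfl, -⟩ := exists_of_mem_overlappingPairs hp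
        rw [endpoints_union, endpoints_edgeSet, endpoints_edgeSet] at hU
        rw [Finset.mem_product, Finset.mem_powerset, Finset.mem_powerset, ← hU]
        exact ⟨edgeSet_subset_edgesIn Finset.subset_union_left,
          edgeSet_subset_edgesIn Finset.subset_union_right⟩
    _ = 2 ^ (2 * (M.edgesIn U).card) := by
        rw [Finset.card_product, Finset.card_powerset, ← pow_add, two_mul]
    _ ≤ 2 ^ (2 * U.card ^ 2) :=
        Nat.pow_le_pow_right two_pos (Nat.mul_le_mul_left 2 (card_edgesIn_le U))

theorem card_overlappingPairs_card_endpoints_eq_le (j : ℕ) :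
    ((M.overlappingPairs n L).filter fun p => (M.endpoints (p.1 ∪ p.2)).card = j).card ≤
      2 ^ (2 * j ^ 2) * n ^ j := by
  calc _ ≤ 2 ^ (2 * j ^ 2) * (Finset.powersetCard j (Finset.univ : Finset (Fin n))).card := by
        refine Finset.card_le_mul_card_image_of_maps_to (f := fun p => M.endpoints (p.1 ∪ p.2))
          (fun p hp => ?_) _ fun U hU => ?_
        · exact Finset.mem_powersetCard.mpr
            ⟨Finset.subset_univ _, (Finset.mem_filter.mp hp).2⟩
        · rw [← (Finset.mem_powersetCard.mp hU).2]
          exact (Finset.card_le_card (Finset.filter_subset_filter _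
            (Finset.filter_subset _ _))).trans (card_overlappingPairs_endpoints_eq_le U)
    _ ≤ 2 ^ (2 * j ^ 2) * n ^ j := by
        rw [Finset.card_powersetCard, Finset.card_univ, Fintype.card_fin]
        gcongr
        exact Nat.choose_le_pow n j

theorem sum_overlappingPairs_pow_le {K : ℝ} (hK : 0 ≤ K) (hn0 : 0 < n) (hKn : K ≤ n) :
    ∑ p ∈ M.overlappingPairs n L, (K / n) ^ (p.1 ∪ p.2).card ≤
      (∑ j ∈ Finset.range (2 * L + 1), 2 ^ (2 * j ^ 2) * K ^ (j + 1)) / n := by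
  have hx0 : 0 ≤ K / n := by positivity
  have hx1 : K / n ≤ 1 := div_le_one_of_le₀ hKn n.cast_nonneg
  calc _ ≤ ∑ p ∈ M.overlappingPairs n L, (K / n) ^ ((M.endpoints (p.1 ∪ p.2)).card + 1) :=
        Finset.sum_le_sum fun p hp =>
          pow_le_pow_of_le_one hx0 hx1 (card_endpoints_lt_of_mem_overlappingPairs hp)
    _ = ∑ j ∈ Finset.range (2 * L + 1), ∑ p ∈ M.overlappingPairs n L with
          (M.endpoints (p.1 ∪ p.2)).card = j, (K / n) ^ ((M.endpoints (p.1 ∪ p.2)).card + 1) :=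
        (Finset.sum_fiberwise_of_maps_to (fun p hp => Finset.mem_range.mpr
          (Nat.lt_succ_of_le (card_endpoints_le_of_mem_overlappingPairs hp))) _).symm
    _ ≤ ∑ j ∈ Finset.range (2 * L + 1), 2 ^ (2 * j ^ 2) * (n : ℝ) ^ j * (K / n) ^ (j + 1) := by
        refine Finset.sum_le_sum fun j _ => ?_
        rw [Finset.sum_congr rfl fun p hp => by rw [(Finset.mem_filter.mp hp).2],
          Finset.sum_const, nsmul_eq_mul]
        gcongr
        exact_mod_cast card_overlappingPairs_card_endpoints_eq_le j
    _ = _ := by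
        rw [Finset.sum_div]
        refine Finset.sum_congr rfl fun j _ => ?_
        rw [div_pow, pow_succ (n : ℝ)]
        field_simp

theorem tendsto_sum_overlappingPairs_pow (M : CycleModel) (L : ℕ) {K : ℝ} (hK : 0 ≤ K) :
    Tendsto (fun n : ℕ => ∑ p ∈ M.overlappingPairs n L, (K / n) ^ (p.1 ∪ p.2).card)
      atTop (𝓝 0) := by
  refine squeeze_zero' (Eventually.of_forall fun n => Finset.sum_nonneg fun p _ => by positivity)
    ?_ (tendsto_const_div_atTop_nhds_zero_nat
      (∑ j ∈ Finset.range (2 * L + 1), 2 ^ (2 * j ^ 2) * K ^ (j + 1)))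
  filter_upwards [eventually_gt_atTop 0, eventually_ge_atTop ⌈K⌉₊] with n hn hKn
  exact sum_overlappingPairs_pow_le hK hn (Nat.ceil_le.mp hKn)

end OverlappingPairs

end CycleModel

/-! ### The directed and the undirected model -/

section Reparametrization

variable {G α : Type*} [AddGroup G]

/-- The cyclic sequence `v`, started at position `j`. -/
def shiftEmb (v : G ↪ α) (j : G) : G ↪ α := (Equiv.addRight j).toEmbedding.trans v

/-- The cyclic sequence `v`, traversed backwards. -/
def revEmb (v : G ↪ α) : G ↪ α := (Equiv.neg G).toEmbedding.trans v

@[simp]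
theorem shiftEmb_apply (v : G ↪ α) (j i : G) : shiftEmb v j i = v (i + j) := rfl

@[simp]
theorem revEmb_apply (v : G ↪ α) (i : G) : revEmb v i = v (-i) := rfl

theorem shiftEmb_injective (v : G ↪ α) : Function.Injective (shiftEmb v) := by
  intro j j' h
  simpa using DFunLike.congr_fun h 0

end Reparametrization

theorem fin_one_add_one_ne_zero {N : ℕ} (hN : 3 ≤ N + 1) : (1 : Fin (N + 1)) + 1 ≠ 0 := by
  intro h
  have hval := congrArg Fin.val h
  rw [Fin.val_add, Fin.val_one', Nat.mod_eq_of_lt (by omega : 1 < N + 1),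
    Nat.mod_eq_of_lt (by omega)] at hval
  exact two_ne_zero hval

/-- The undirected edge underlying an arc. -/
def Arc.toUEdge {n : ℕ} (a : Arc n) : UEdge n :=
  ⟨s(a.1.1, a.1.2), fun h => a.2 (Sym2.mk_isDiag_iff.mp h)⟩

namespace DirCycle

variable {n N : ℕ} {E : Type*} [DecidableEq E] (f : Arc n → E)

theorem exists_eq_of_edgeSetOf_eq {f : Arc n → E} {C C' : DirCycle n}
    (h : C'.edgeSetOf f = C.edgeSetOf f) (i : Fin C'.length) :
    ∃ m, f (C.arc m) = f (C'.arc i) := by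
  have hmem : f (C'.arc i) ∈ C.edgeSetOf f :=
    h ▸ Finset.mem_image_of_mem (fun i => f (C'.arc i)) (Finset.mem_univ i)
  obtain ⟨m, -, hm⟩ := Finset.mem_image.mp hmem
  exact ⟨m, hm⟩

variable (h : 2 ≤ N + 1) (v : Fin (N + 1) ↪ Fin n)

theorem arc_mk_val (i : Fin (N + 1)) :
    ((⟨N + 1, h, v⟩ : DirCycle n).arc i).1 = (v i, v (i + 1)) := by
  simp only [arc, finRotate_apply]

theorem arc_shiftEmb (j i : Fin (N + 1)) :
    (⟨N + 1, h, shiftEmb v j⟩ : DirCycle n).arc i = (⟨N + 1, h, v⟩ : DirCycle n).arc (i + j) := by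
  apply Subtype.ext
  rw [arc_mk_val, arc_mk_val, shiftEmb_apply, shiftEmb_apply, add_right_comm]

theorem toUEdge_arc_revEmb (i : Fin (N + 1)) :
    ((⟨N + 1, h, revEmb v⟩ : DirCycle n).arc i).toUEdge =
      ((⟨N + 1, h, v⟩ : DirCycle n).arc (-(i + 1))).toUEdge := by
  apply Subtype.ext
  simp only [Arc.toUEdge, arc_mk_val, revEmb_apply]
  rw [Sym2.eq_swap, neg_add, neg_add_cancel_right]

theorem edgeSetOf_shiftEmb (j : Fin (N + 1)) :
    (⟨N + 1, h, shiftEmb v j⟩ : DirCycle n).edgeSetOf f =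
      (⟨N + 1, h, v⟩ : DirCycle n).edgeSetOf f := by
  ext e
  simp only [edgeSetOf, arc_shiftEmb, Finset.mem_image, Finset.mem_univ, true_and]
  exact ((Equiv.addRight j).surjective.exists
    (p := fun i => f ((⟨N + 1, h, v⟩ : DirCycle n).arc i) = e)).symm

theorem edgeSetOf_toUEdge_revEmb :
    (⟨N + 1, h, revEmb v⟩ : DirCycle n).edgeSetOf Arc.toUEdge =
      (⟨N + 1, h, v⟩ : DirCycle n).edgeSetOf Arc.toUEdge := by
  ext e
  simp only [edgeSetOf, toUEdge_arc_revEmb, Finset.mem_image, Finset.mem_univ, true_and]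
  exact (((Equiv.addRight (1 : Fin (N + 1))).trans (Equiv.neg _)).surjective.exists
    (p := fun i => ((⟨N + 1, h, v⟩ : DirCycle n).arc i).toUEdge = e)).symm

variable {v} {v' : Fin (N + 1) ↪ Fin n}

theorem edgeSetOf_id_eq_iff :
    (⟨N + 1, h, v'⟩ : DirCycle n).edgeSetOf id = (⟨N + 1, h, v⟩ : DirCycle n).edgeSetOf id ↔
      ∃ j, shiftEmb v j = v' := by
  refine ⟨fun heq => ?_, ?_⟩
  · have harc (i) : ∃ m, v m = v' i ∧ v (m + 1) = v' (i + 1) := by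
      obtain ⟨m, hm⟩ := exists_eq_of_edgeSetOf_eq heq i
      have hval := congrArg Subtype.val hm
      simp only [id_eq, arc_mk_val, Prod.mk.injEq] at hval
      exact ⟨m, hval⟩
    obtain ⟨j, hj, -⟩ := harc 0
    refine ⟨j, ?_⟩
    ext1 i
    rw [shiftEmb_apply]
    induction i using Fin.induction with
    | zero => rw [zero_add, hj]
    | succ i ih =>
      obtain ⟨m, hm, hm'⟩ := harc i.castSucc
      rw [← Fin.coeSucc_eq_succ, ← hm', ← v.injective (ih.trans hm.symm), add_right_comm]
  · rintro ⟨j, rfl⟩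
    exact edgeSetOf_shiftEmb id h v j

/-- Once the first edges are aligned, the next one cannot be traversed backwards, since that would
return to the vertex just left. -/
theorem shiftEmb_eq_of_edgeSetOf_toUEdge_eq (h3 : 3 ≤ N + 1)
    (heq : (⟨N + 1, h, v'⟩ : DirCycle n).edgeSetOf Arc.toUEdge =
      (⟨N + 1, h, v⟩ : DirCycle n).edgeSetOf Arc.toUEdge)
    {j : Fin (N + 1)} (h0 : v j = v' 0) (h1 : v (j + 1) = v' 1) : shiftEmb v j = v' := by
  suffices key : ∀ i, v (i + j) = v' i ∧ v (i + 1 + j) = v' (i + 1) from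
    DFunLike.ext _ _ fun i => (key i).1
  intro i
  induction i using Fin.induction with
  | zero => simpa only [zero_add, add_comm 1 j] using ⟨h0, h1⟩
  | succ i ih =>
    rw [← Fin.coeSucc_eq_succ]
    generalize i.castSucc = i at ih ⊢
    refine ⟨ih.2, ?_⟩
    obtain ⟨m, hm⟩ := exists_eq_of_edgeSetOf_eq heq (i + 1)
    have hval := congrArg Subtype.val hm
    simp only [Arc.toUEdge, arc_mk_val, Sym2.eq_iff] at hval
    rcases hval with ⟨hm1, hm2⟩ | ⟨hm1, hm2⟩
    · rw [← hm2, ← v.injective (ih.2.trans hm1.symm), add_right_comm _ j]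
    · have hmj : i + j = m := by
        have hnext := v.injective (ih.2.trans hm2.symm)
        rwa [add_right_comm, add_left_inj] at hnext
      have hback := v'.injective ((ih.1.symm.trans (congrArg v hmj)).trans hm1)
      rw [add_assoc, left_eq_add] at hback
      exact absurd hback (fin_one_add_one_ne_zero h3)

theorem edgeSetOf_toUEdge_eq_iff (h3 : 3 ≤ N + 1) :
    (⟨N + 1, h, v'⟩ : DirCycle n).edgeSetOf Arc.toUEdge =
      (⟨N + 1, h, v⟩ : DirCycle n).edgeSetOf Arc.toUEdge ↔
      (∃ j, shiftEmb v j = v') ∨ ∃ j, shiftEmb (revEmb v) j = v' := by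
  refine ⟨fun heq => ?_, ?_⟩
  · obtain ⟨m, hm⟩ := exists_eq_of_edgeSetOf_eq heq 0
    have hval := congrArg Subtype.val hm
    simp only [Arc.toUEdge, arc_mk_val, zero_add, Sym2.eq_iff] at hval
    rcases hval with ⟨hm1, hm2⟩ | ⟨hm1, hm2⟩
    · exact Or.inl ⟨m, shiftEmb_eq_of_edgeSetOf_toUEdge_eq h h3 heq hm1 hm2⟩
    · refine Or.inr ⟨-(m + 1), shiftEmb_eq_of_edgeSetOf_toUEdge_eq h h3
        (heq.trans (edgeSetOf_toUEdge_revEmb h v).symm) ?_ ?_⟩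
      · rw [revEmb_apply, neg_neg, hm2]
      · rw [revEmb_apply, neg_add, neg_neg, add_neg_cancel_right, hm1]
  · rintro (⟨j, rfl⟩ | ⟨j, rfl⟩)
    · exact edgeSetOf_shiftEmb _ h v j
    · rw [edgeSetOf_shiftEmb, edgeSetOf_toUEdge_revEmb]

theorem toUEdge_arc_injective (C : DirCycle n) (hC : 3 ≤ C.length) :
    Function.Injective fun i => (C.arc i).toUEdge := by
  obtain ⟨_ | N, h, v⟩ := C
  · exact absurd h (by decide)
  intro i j hij
  have hval := congrArg Subtype.val hij
  simp only [Arc.toUEdge, arc_mk_val, Sym2.eq_iff] at hval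
  rcases hval with ⟨h1, -⟩ | ⟨h1, h2⟩
  · exact v.injective h1
  · have hback := v.injective h2
    rw [v.injective h1, add_assoc, add_eq_left] at hback
    exact absurd hback (fin_one_add_one_ne_zero hC)

end DirCycle

theorem shiftEmb_ne_shiftEmb_revEmb {α : Type*} {N : ℕ} (h3 : 3 ≤ N + 1) (v : Fin (N + 1) ↪ α)
    (j j' : Fin (N + 1)) : shiftEmb v j ≠ shiftEmb (revEmb v) j' := by
  intro heq
  have h0 := v.injective (DFunLike.congr_fun heq 0)
  have h1 := v.injective (DFunLike.congr_fun heq 1)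
  simp only [Equiv.coe_toEmbedding, Equiv.coe_addRight, Equiv.neg_apply, zero_add] at h0 h1
  rw [h0, neg_add, add_left_inj] at h1
  exact fin_one_add_one_ne_zero h3 (eq_neg_iff_add_eq_zero.mp h1)

/-- The complete directed graphs. -/
def dirModel : CycleModel where
  Edge := Arc
  ofArc := id
  ends := fun a => {a.1.1, a.1.2}
  ends_ofArc := fun _ => rfl
  minLen := 2
  two_le_minLen := le_rfl
  mult := 1
  mult_pos := one_pos
  edge_injective := fun C _ _ _ hij => C.vert.injective (congrArg (fun a => a.1.1) hij)
  card_fiber := by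
    rintro n ⟨_ | N, h, v⟩ -
    · exact absurd h (by decide)
    have hfiber : (Finset.univ.filter fun v' : Fin (N + 1) ↪ Fin n =>
        (⟨N + 1, h, v'⟩ : DirCycle n).edgeSetOf id = (⟨N + 1, h, v⟩ : DirCycle n).edgeSetOf id) =
        Finset.univ.image (shiftEmb v) := by
      ext v'
      simp only [DirCycle.edgeSetOf_id_eq_iff h, Finset.mem_filter, Finset.mem_image,
        Finset.mem_univ, true_and]
    rw [hfiber, Finset.card_image_of_injective _ (shiftEmb_injective v), Finset.card_univ,
      Fintype.card_fin, one_mul]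

/-- The complete undirected graphs. A cycle is represented by the directed cycles that traverse it
in either direction. -/
def undirModel : CycleModel where
  Edge := UEdge
  ofArc := Arc.toUEdge
  ends := fun e => Finset.univ.filter fun x => x ∈ e.1
  ends_ofArc := fun a => by
    ext x
    simp [Arc.toUEdge]
  minLen := 3
  two_le_minLen := by norm_num
  mult := 2
  mult_pos := two_pos
  edge_injective := DirCycle.toUEdge_arc_injective
  card_fiber := by
    rintro n ⟨_ | N, h, v⟩ h3
    · exact absurd h (by decide)
    have hfiber : (Finset.univ.filter fun v' : Fin (N + 1) ↪ Fin n =>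
        (⟨N + 1, h, v'⟩ : DirCycle n).edgeSetOf Arc.toUEdge =
          (⟨N + 1, h, v⟩ : DirCycle n).edgeSetOf Arc.toUEdge) =
        Finset.univ.image (shiftEmb v) ∪ Finset.univ.image (shiftEmb (revEmb v)) := by
      ext v'
      simp only [DirCycle.edgeSetOf_toUEdge_eq_iff h h3, Finset.mem_filter, Finset.mem_union,
        Finset.mem_image, Finset.mem_univ, true_and]
    have hdisj : Disjoint (Finset.univ.image (shiftEmb v))
        (Finset.univ.image (shiftEmb (revEmb v))) := by
      refine Finset.disjoint_left.mpr fun v' h1 h2 => ?_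
      obtain ⟨j, -, rfl⟩ := Finset.mem_image.mp h1
      obtain ⟨j', -, hj'⟩ := Finset.mem_image.mp h2
      exact shiftEmb_ne_shiftEmb_revEmb h3 v j j' hj'.symm
    rw [hfiber, Finset.card_union_of_disjoint hdisj,
      Finset.card_image_of_injective _ (shiftEmb_injective _),
      Finset.card_image_of_injective _ (shiftEmb_injective _), Finset.card_univ,
      Fintype.card_fin, two_mul]

/-! ### Limiting intensities -/

section Stirling

variable {k : ℕ}

theorem sqrt_mul_div_exp_one_pow_le_factorial (k : ℕ) :
    Real.sqrt k * (k / Real.exp 1) ^ k ≤ k.factorial := by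
  refine le_trans ?_ (Stirling.le_factorial_stirling k)
  gcongr
  nlinarith [Real.pi_gt_three, k.cast_nonneg (α := ℝ)]

theorem factorial_le_exp_one_mul_mul_div_exp_one_pow (hk : k ≠ 0) :
    (k.factorial : ℝ) ≤ Real.exp 1 * k * (k / Real.exp 1) ^ k := by
  have hanti : Stirling.stirlingSeq k ≤ Stirling.stirlingSeq 1 := by
    obtain ⟨j, rfl⟩ := Nat.exists_eq_succ_of_ne_zero hk
    exact Stirling.stirlingSeq'_antitone j.zero_le
  have hk1 : (1 : ℝ) ≤ k := by exact_mod_cast Nat.one_le_iff_ne_zero.mpr hk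
  rw [Stirling.stirlingSeq_one, Stirling.stirlingSeq, div_le_iff₀ (by positivity)] at hanti
  calc (k.factorial : ℝ)
      ≤ Real.exp 1 / Real.sqrt 2 * (Real.sqrt (2 * k) * (k / Real.exp 1) ^ k) := hanti
    _ = Real.exp 1 * Real.sqrt k * (k / Real.exp 1) ^ k := by
        rw [Real.sqrt_mul zero_le_two]
        field_simp
    _ ≤ Real.exp 1 * k * (k / Real.exp 1) ^ k := by
        gcongr
        exact Real.sqrt_le_iff.mpr ⟨by positivity, by nlinarith⟩

end Stirling

theorem exp_neg_le_exp_neg_add_sub {x y : ℝ} (hx : 0 ≤ x) (hxy : x ≤ y) :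
    Real.exp (-x) ≤ Real.exp (-y) + (y - x) := by
  have hmul : Real.exp (-y) = Real.exp (-x) * Real.exp (-(y - x)) := by
    rw [← Real.exp_add]
    ring_nf
  have htangent : 1 - (y - x) ≤ Real.exp (-(y - x)) := Real.one_sub_le_exp_neg _
  have hle : Real.exp (-x) ≤ 1 := Real.exp_le_one_iff.mpr (neg_nonpos.mpr hx)
  nlinarith [Real.exp_pos (-x)]

/-- The limiting expected number of cycles of length `k` and mean weight at most `c / n`, when each
cycle is represented by `m * k` sequences of vertices. -/
noncomputable def intensity (m k : ℕ) (c : ℝ) : ℝ := (k * c) ^ k / (m * k * k.factorial)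

/-- The derivative of `intensity m k`: the density of the mean weights of the cycles of length `k`,
on the scale `1 / n`. -/
noncomputable def intensityDeriv (m k : ℕ) (c : ℝ) : ℝ :=
  c ^ (k - 1) * (k : ℝ) ^ k / (m * k.factorial)

/-- The limiting expected number of cycles of length between `l` and `L` and mean weight at most
`c / n`. -/
noncomputable def partialIntensity (m l L : ℕ) (c : ℝ) : ℝ :=
  ∑ k ∈ Finset.Icc l L, intensity m k c

/-- The limiting expected number of cycles of length at least `l` and mean weight at most `c / n`,
for `c ≤ 1 / e`. -/
noncomputable def totalIntensity (m l : ℕ) (c : ℝ) : ℝ := ∑' j, intensity m (j + l) c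

/-- The limiting probability that the minimum mean-weight cycle has length `k`, when the cycles have
length at least `l`. -/
noncomputable def limitProb (m l k : ℕ) : ℝ :=
  ∫ c in (0 : ℝ)..(1 / Real.exp 1), intensityDeriv m k c * Real.exp (-totalIntensity m l c)

section Intensity

variable {m k l L : ℕ} {b c d : ℝ}

theorem intensity_nonneg (hc : 0 ≤ c) : 0 ≤ intensity m k c := by
  unfold intensity
  positivity

theorem intensityDeriv_nonneg (hc : 0 ≤ c) : 0 ≤ intensityDeriv m k c := by
  unfold intensityDeriv
  positivity

theorem intensity_mono (hc : 0 ≤ c) (hcd : c ≤ d) : intensity m k c ≤ intensity m k d := by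
  unfold intensity
  gcongr

theorem intensity_zero (hk : k ≠ 0) : intensity m k 0 = 0 := by
  rw [intensity, mul_zero, zero_pow hk, zero_div]

theorem intensity_eq_intensity_one_div (m k : ℕ) (c : ℝ) :
    intensity m k c = intensity 1 k c / m := by
  rw [intensity, intensity, div_div, Nat.cast_one, one_mul, mul_assoc, mul_comm (m : ℝ)]

theorem continuous_intensity : Continuous (intensity m k) := by
  unfold intensity
  fun_prop

theorem continuous_intensityDeriv : Continuous (intensityDeriv m k) := by
  unfold intensityDeriv
  fun_prop

theorem hasDerivAt_intensity (hk : k ≠ 0) (c : ℝ) :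
    HasDerivAt (intensity m k) (intensityDeriv m k c) c := by
  have hpow := (hasDerivAt_pow k c).mul_const ((k : ℝ) ^ k / (k * (m * k.factorial)))
  refine (hpow.congr_deriv ?_).congr_of_eventuallyEq (Eventually.of_forall fun x => ?_)
  · have hk0 : (k : ℝ) ≠ 0 := Nat.cast_ne_zero.mpr hk
    rw [intensityDeriv]
    field_simp
  · simp only [intensity]
    ring

theorem intensity_one_div_exp_one_le (hm : 0 < m) (hk : k ≠ 0) :
    intensity m k (1 / Real.exp 1) ≤ 1 / (k : ℝ) ^ (3 / 2 : ℝ) := by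
  have hk0 : (0 : ℝ) < k := by positivity
  have hm1 : (1 : ℝ) ≤ m := by exact_mod_cast hm
  have hpow : (k : ℝ) ^ (3 / 2 : ℝ) = k * Real.sqrt k := by
    rw [Real.sqrt_eq_rpow, show (3 / 2 : ℝ) = 1 + 1 / 2 by norm_num, Real.rpow_add hk0,
      Real.rpow_one]
  rw [intensity, hpow, mul_one_div, div_le_div_iff₀ (by positivity) (by positivity), one_mul]
  calc (k / Real.exp 1) ^ k * (k * Real.sqrt k)
      = 1 * k * (Real.sqrt k * (k / Real.exp 1) ^ k) := by ring
    _ ≤ m * k * k.factorial := by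
        gcongr
        exact sqrt_mul_div_exp_one_pow_le_factorial k

theorem summable_intensity (hm : 0 < m) (h0 : 0 ≤ c) (hc : c ≤ 1 / Real.exp 1) :
    Summable fun k => intensity m k c := by
  refine Summable.of_norm_bounded_eventually_nat
    (Real.summable_one_div_nat_rpow.mpr (by norm_num : (1 : ℝ) < 3 / 2)) ?_
  filter_upwards [eventually_ne_atTop 0] with k hk
  rw [Real.norm_of_nonneg (intensity_nonneg h0)]
  exact (intensity_mono h0 hc).trans (intensity_one_div_exp_one_le hm hk)

theorem summable_intensity_add (hm : 0 < m) (l : ℕ) (h0 : 0 ≤ c) (hc : c ≤ 1 / Real.exp 1) :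
    Summable fun j => intensity m (j + l) c :=
  (summable_nat_add_iff l).mpr (summable_intensity hm h0 hc)

theorem pow_div_sq_le_intensity (hm : 0 < m) (hk : k ≠ 0) (hb : 0 ≤ b) :
    1 / (m * Real.exp 1) * ((Real.exp 1 * b) ^ k / (k : ℝ) ^ 2) ≤ intensity m k b := by
  rw [intensity, le_div_iff₀ (by positivity)]
  calc 1 / (m * Real.exp 1) * ((Real.exp 1 * b) ^ k / (k : ℝ) ^ 2) * (m * k * k.factorial)
      ≤ 1 / (m * Real.exp 1) * ((Real.exp 1 * b) ^ k / (k : ℝ) ^ 2) *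
        (m * k * (Real.exp 1 * k * (k / Real.exp 1) ^ k)) := by
        gcongr
        exact factorial_le_exp_one_mul_mul_div_exp_one_pow hk
    _ = (k * b) ^ k := by
        rw [mul_pow, div_pow, mul_pow]
        field_simp

theorem tendsto_intensity_atTop (hm : 0 < m) (hb : 1 / Real.exp 1 < b) :
    Tendsto (fun k => intensity m k b) atTop atTop := by
  have hb0 : 0 < b := lt_trans (by positivity) hb
  have hr : 1 < Real.exp 1 * b := by rwa [div_lt_iff₀' (Real.exp_pos 1)] at hb
  have hlim : Tendsto (fun k : ℕ => (Real.exp 1 * b) ^ k / (k : ℝ) ^ 2) atTop atTop := by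
    have hinv : Tendsto (fun k : ℕ => (k : ℝ) ^ 2 / (Real.exp 1 * b) ^ k) atTop (𝓝[>] 0) := by
      refine tendsto_nhdsWithin_iff.mpr ⟨tendsto_pow_const_div_const_pow_of_one_lt 2 hr, ?_⟩
      filter_upwards [eventually_gt_atTop 0] with k hk
      exact Set.mem_Ioi.mpr (by positivity)
    exact hinv.inv_tendsto_nhdsGT_zero.congr fun k => inv_div _ _
  have hpos : 0 < 1 / (m * Real.exp 1) := by positivity
  refine tendsto_atTop_mono' _ ?_ (hlim.const_mul_atTop hpos)
  filter_upwards [eventually_ne_atTop 0] with k hk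
  exact pow_div_sq_le_intensity hm hk hb0.le

theorem partialIntensity_nonneg (l L : ℕ) (hc : 0 ≤ c) : 0 ≤ partialIntensity m l L c :=
  Finset.sum_nonneg fun _ _ => intensity_nonneg hc

theorem partialIntensity_zero (hl : 0 < l) : partialIntensity m l L 0 = 0 :=
  Finset.sum_eq_zero fun _ hk => intensity_zero (hl.trans_le (Finset.mem_Icc.mp hk).1).ne'

theorem continuous_partialIntensity (l L : ℕ) : Continuous (partialIntensity m l L) :=
  continuous_finsetSum _ fun _ _ => continuous_intensity

theorem hasDerivAt_partialIntensity (hl : 0 < l) (L : ℕ) (c : ℝ) :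
    HasDerivAt (partialIntensity m l L) (∑ k ∈ Finset.Icc l L, intensityDeriv m k c) c :=
  HasDerivAt.fun_sum fun _ hk =>
    hasDerivAt_intensity (hl.trans_le (Finset.mem_Icc.mp hk).1).ne' c

theorem tendsto_partialIntensity_atTop (hm : 0 < m) (l : ℕ) (hb : 1 / Real.exp 1 < b) :
    Tendsto (fun L => partialIntensity m l L b) atTop atTop := by
  have hb0 : 0 ≤ b := le_trans (by positivity) hb.le
  refine tendsto_atTop_mono' _ ?_ (tendsto_intensity_atTop hm hb)
  filter_upwards [eventually_ge_atTop l] with L hL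
  exact Finset.single_le_sum (f := fun k => intensity m k b) (fun _ _ => intensity_nonneg hb0)
    (Finset.mem_Icc.mpr ⟨hL, le_rfl⟩)

theorem totalIntensity_nonneg (m l : ℕ) (hc : 0 ≤ c) : 0 ≤ totalIntensity m l c :=
  tsum_nonneg fun _ => intensity_nonneg hc

theorem totalIntensity_mono (hm : 0 < m) (l : ℕ) (h0 : 0 ≤ c) (hcd : c ≤ d)
    (hd : d ≤ 1 / Real.exp 1) : totalIntensity m l c ≤ totalIntensity m l d :=
  (summable_intensity_add hm l h0 (hcd.trans hd)).tsum_le_tsum (fun _ => intensity_mono h0 hcd)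
    (summable_intensity_add hm l (h0.trans hcd) hd)

theorem partialIntensity_add_totalIntensity (hm : 0 < m) (hL : l ≤ L + 1) (h0 : 0 ≤ c)
    (hc : c ≤ 1 / Real.exp 1) :
    partialIntensity m l L c + totalIntensity m (L + 1) c = totalIntensity m l c := by
  obtain ⟨J, hJ⟩ := Nat.exists_eq_add_of_le hL
  have hpartial : partialIntensity m l L c = ∑ j ∈ Finset.range J, intensity m (j + l) c := by
    rw [partialIntensity, Finset.range_eq_Ico, Finset.sum_Ico_add' (fun k => intensity m k c),
      zero_add, add_comm J, ← hJ, Finset.Ico_add_one_right_eq_Icc]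
  rw [totalIntensity.eq_1 m l, ← (summable_intensity_add hm l h0 hc).sum_add_tsum_nat_add J,
    hpartial, totalIntensity, hJ]
  simp only [add_assoc, add_comm l J]

theorem partialIntensity_le_totalIntensity (hm : 0 < m) (l L : ℕ) (h0 : 0 ≤ c)
    (hc : c ≤ 1 / Real.exp 1) : partialIntensity m l L c ≤ totalIntensity m l c := by
  rcases le_or_gt l (L + 1) with hL | hL
  · rw [← partialIntensity_add_totalIntensity hm hL h0 hc]
    exact le_add_of_nonneg_right (totalIntensity_nonneg m (L + 1) h0)
  · rw [partialIntensity, Finset.Icc_eq_empty (by omega), Finset.sum_empty]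
    exact totalIntensity_nonneg m l h0

theorem tendsto_totalIntensity_add_one (m : ℕ) (c : ℝ) :
    Tendsto (fun L => totalIntensity m (L + 1) c) atTop (𝓝 0) :=
  (tendsto_sum_nat_add fun k => intensity m k c).comp (tendsto_add_atTop_nat 1)

theorem continuousOn_totalIntensity (hm : 0 < m) (l : ℕ) :
    ContinuousOn (totalIntensity m l) (Set.Icc 0 (1 / Real.exp 1)) := by
  refine continuousOn_tsum (fun j => continuous_intensity.continuousOn)
    (summable_intensity_add hm l (by positivity) le_rfl) fun j c hc => ?_
  rw [Real.norm_of_nonneg (intensity_nonneg hc.1)]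
  exact intensity_mono hc.1 hc.2

theorem treeFunction_eq_totalIntensity (c : ℝ) : treeFunction c = totalIntensity 1 1 c := by
  refine tsum_congr fun j => ?_
  have hj : ((j + 1 : ℕ) : ℝ) ≠ 0 := by positivity
  rw [intensity, mul_pow, pow_succ ((j + 1 : ℕ) : ℝ) j, Nat.cast_one, one_mul]
  field_simp

theorem totalIntensity_add_one_eq_treeFunction (m l : ℕ) (h0 : 0 ≤ c)
    (hc : c ≤ 1 / Real.exp 1) :
    totalIntensity m (l + 1) c = (treeFunction c - partialIntensity 1 1 l c) / m := by
  rw [treeFunction_eq_totalIntensity,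
    ← partialIntensity_add_totalIntensity one_pos (Nat.le_add_left 1 l) h0 hc,
    add_sub_cancel_left, totalIntensity, totalIntensity, ← tsum_div_const]
  exact tsum_congr fun j => intensity_eq_intensity_one_div _ _ _

end Intensity

/-! ### Limiting probabilities -/

section LimitProb

variable {m k l L : ℕ}

theorem intervalIntegrable_intensityDeriv_mul_exp_neg_partialIntensity (m k l L : ℕ) (a b : ℝ) :
    IntervalIntegrable (fun c => intensityDeriv m k c * Real.exp (-partialIntensity m l L c))
      volume a b :=
  (continuous_intensityDeriv.mul (continuous_partialIntensity l L).neg.rexp).intervalIntegrable _ _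

theorem intervalIntegrable_intensityDeriv_mul_exp_neg_totalIntensity (hm : 0 < m) (k l : ℕ) :
    IntervalIntegrable (fun c => intensityDeriv m k c * Real.exp (-totalIntensity m l c)) volume 0
      (1 / Real.exp 1) := by
  refine ContinuousOn.intervalIntegrable ?_
  rw [Set.uIcc_of_le (by positivity)]
  exact continuous_intensityDeriv.continuousOn.mul (continuousOn_totalIntensity hm l).neg.rexp

theorem limitProb_nonneg (m l k : ℕ) : 0 ≤ limitProb m l k :=
  intervalIntegral.integral_nonneg (by positivity) fun _ hc =>
    mul_nonneg (intensityDeriv_nonneg hc.1) (Real.exp_pos _).le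

theorem limitProb_le_integral (hm : 0 < m) (l L k : ℕ) :
    limitProb m l k ≤ ∫ c in (0 : ℝ)..(1 / Real.exp 1),
      intensityDeriv m k c * Real.exp (-partialIntensity m l L c) := by
  refine intervalIntegral.integral_mono_on (by positivity)
    (intervalIntegrable_intensityDeriv_mul_exp_neg_totalIntensity hm k l)
    (intervalIntegrable_intensityDeriv_mul_exp_neg_partialIntensity m k l L _ _) fun c hc => ?_
  have hderiv := intensityDeriv_nonneg (m := m) (k := k) hc.1
  gcongr
  exact partialIntensity_le_totalIntensity hm l L hc.1 hc.2

theorem integral_intensityDeriv (m : ℕ) (hk : k ≠ 0) (a b : ℝ) :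
    ∫ c in a..b, intensityDeriv m k c = intensity m k b - intensity m k a :=
  intervalIntegral.integral_eq_sub_of_hasDerivAt (fun c _ => hasDerivAt_intensity hk c)
    (continuous_intensityDeriv.intervalIntegrable _ _)

theorem integral_le_integral_add_sub {a b : ℝ} (m l L : ℕ) (hk : k ≠ 0) (ha : 0 ≤ a)
    (hab : a ≤ b) :
    ∫ c in (0 : ℝ)..b, intensityDeriv m k c * Real.exp (-partialIntensity m l L c) ≤
      (∫ c in (0 : ℝ)..a, intensityDeriv m k c * Real.exp (-partialIntensity m l L c)) +
        (intensity m k b - intensity m k a) := by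
  have hint := intervalIntegrable_intensityDeriv_mul_exp_neg_partialIntensity m k l L
  rw [← intervalIntegral.integral_add_adjacent_intervals (hint 0 a) (hint a b), add_le_add_iff_left,
    ← integral_intensityDeriv m hk]
  refine intervalIntegral.integral_mono_on hab (hint a b)
    (continuous_intensityDeriv.intervalIntegrable _ _) fun c hc => ?_
  have hc0 := ha.trans hc.1
  exact mul_le_of_le_one_right (intensityDeriv_nonneg hc0)
    (Real.exp_le_one_iff.mpr (neg_nonpos.mpr (partialIntensity_nonneg l L hc0)))

theorem integral_le_limitProb_add (hm : 0 < m) (hL : l ≤ L + 1) (hk : k ≠ 0) :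
    ∫ c in (0 : ℝ)..(1 / Real.exp 1),
        intensityDeriv m k c * Real.exp (-partialIntensity m l L c) ≤
      limitProb m l k +
        intensity m k (1 / Real.exp 1) * totalIntensity m (L + 1) (1 / Real.exp 1) := by
  have htotal := intervalIntegrable_intensityDeriv_mul_exp_neg_totalIntensity hm k l
  have htail : IntervalIntegrable
      (fun c => intensityDeriv m k c * totalIntensity m (L + 1) (1 / Real.exp 1)) volume 0
      (1 / Real.exp 1) :=
    (continuous_intensityDeriv.mul continuous_const).intervalIntegrable _ _
  have hintensity : intensity m k (1 / Real.exp 1) =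
      ∫ c in (0 : ℝ)..(1 / Real.exp 1), intensityDeriv m k c := by
    rw [integral_intensityDeriv m hk, intensity_zero hk, sub_zero]
  rw [hintensity, limitProb, ← intervalIntegral.integral_mul_const,
    ← intervalIntegral.integral_add htotal htail]
  refine intervalIntegral.integral_mono_on (by positivity)
    (intervalIntegrable_intensityDeriv_mul_exp_neg_partialIntensity m k l L _ _)
    (htotal.add htail) fun c hc => ?_
  rw [← mul_add]
  refine mul_le_mul_of_nonneg_left ?_ (intensityDeriv_nonneg hc.1)
  have hsplit := partialIntensity_add_totalIntensity hm hL hc.1 hc.2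
  have hmono := totalIntensity_mono hm (L + 1) hc.1 hc.2 le_rfl
  have hexp := exp_neg_le_exp_neg_add_sub (partialIntensity_nonneg (m := m) l L hc.1)
    (partialIntensity_le_totalIntensity hm l L hc.1 hc.2)
  linarith

theorem sum_integral_intensityDeriv_mul_exp_neg_partialIntensity (m : ℕ) (hl : 0 < l) (L : ℕ)
    (b : ℝ) :
    ∑ k ∈ Finset.Icc l L, ∫ c in (0 : ℝ)..b,
        intensityDeriv m k c * Real.exp (-partialIntensity m l L c) =
      1 - Real.exp (-partialIntensity m l L b) := by
  have hderiv (c : ℝ) : HasDerivAt (fun c => -Real.exp (-partialIntensity m l L c))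
      (∑ k ∈ Finset.Icc l L, intensityDeriv m k c * Real.exp (-partialIntensity m l L c)) c := by
    refine (hasDerivAt_partialIntensity hl L c).fun_neg.exp.fun_neg.congr_deriv ?_
    rw [← Finset.sum_mul]
    ring
  have hcont : Continuous fun c =>
      ∑ k ∈ Finset.Icc l L, intensityDeriv m k c * Real.exp (-partialIntensity m l L c) :=
    continuous_finsetSum _ fun k _ =>
      continuous_intensityDeriv.mul (continuous_partialIntensity l L).neg.rexp
  rw [← intervalIntegral.integral_finsetSum fun k _ =>
      intervalIntegrable_intensityDeriv_mul_exp_neg_partialIntensity m k l L 0 b,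
    intervalIntegral.integral_eq_sub_of_hasDerivAt (fun c _ => hderiv c)
      (hcont.intervalIntegrable _ _), partialIntensity_zero hl, neg_zero, Real.exp_zero]
  ring

theorem sum_limitProb_le (hm : 0 < m) (hl : 0 < l) (L : ℕ) :
    ∑ k ∈ Finset.Icc l L, limitProb m l k ≤
      1 - Real.exp (-totalIntensity m l (1 / Real.exp 1)) := by
  refine (Finset.sum_le_sum fun k _ => limitProb_le_integral hm l L k).trans ?_
  rw [sum_integral_intensityDeriv_mul_exp_neg_partialIntensity m hl]
  gcongr
  exact partialIntensity_le_totalIntensity hm l L (by positivity) le_rfl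

theorem sum_range_limitProb_add_le (hm : 0 < m) (hl : 0 < l) (J : ℕ) :
    ∑ j ∈ Finset.range J, limitProb m l (j + l) ≤
      1 - Real.exp (-totalIntensity m l (1 / Real.exp 1)) := by
  refine le_trans ?_ (sum_limitProb_le hm hl (J + l))
  rw [Finset.range_eq_Ico, Finset.sum_Ico_add' (fun k => limitProb m l k), zero_add]
  exact Finset.sum_le_sum_of_subset_of_nonneg Finset.Ico_subset_Icc_self
    fun k _ _ => limitProb_nonneg m l k

theorem summable_limitProb_add (hm : 0 < m) (hl : 0 < l) :
    Summable fun j => limitProb m l (j + l) :=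
  summable_of_sum_range_le (fun j => limitProb_nonneg m l (j + l))
    (sum_range_limitProb_add_le hm hl)

theorem tsum_limitProb_add_lt_one (hm : 0 < m) (hl : 0 < l) :
    ∑' j, limitProb m l (j + l) < 1 :=
  (Real.tsum_le_of_sum_range_le (fun j => limitProb_nonneg m l (j + l))
    (sum_range_limitProb_add_le hm hl)).trans_lt (sub_lt_self 1 (Real.exp_pos _))

end LimitProb

/-! ### Light cycles -/

namespace CycleModel

/-- The event that the edges in `S` have mean weight at most `x / n`. -/
def light (M : CycleModel) (n : ℕ) (x : ℝ) (S : Finset (M.Edge n)) : Set (M.Edge n → ℝ) :=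
  weightLE S (S.card * x / n)

/-- The event that no cycle of length `k ≤ L` has mean weight at most `τ k / n`. -/
def avoid (M : CycleModel) (n L : ℕ) (τ : ℕ → ℝ) : Set (M.Edge n → ℝ) :=
  ⋂ S ∈ M.shortSets n L, (M.light n (τ S.card) S)ᶜ

variable {M : CycleModel} {n k L : ℕ} {x K : ℝ} {τ : ℕ → ℝ} {S T : Finset (M.Edge n)}

theorem measurableSet_light (x : ℝ) (S : Finset (M.Edge n)) : MeasurableSet (M.light n x S) :=
  measurableSet_weightLE S _

theorem measurableSet_avoid (L : ℕ) (τ : ℕ → ℝ) : MeasurableSet (M.avoid n L τ) :=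
  Finset.measurableSet_biInter _ fun S _ => (measurableSet_light _ S).compl

theorem sum_light_le (hk : M.minLen ≤ k) (hx : 0 ≤ x) :
    ∑ S ∈ M.cycleSets n k, (expWeights (M.Edge n)).real (M.light n x S) ≤
      n.descFactorial k / (n : ℝ) ^ k * intensity M.mult k x := by
  calc _ ≤ ∑ _ ∈ M.cycleSets n k, (k * x / n) ^ k / (k.factorial : ℝ) := by
        refine Finset.sum_le_sum fun _ hS => ?_
        rw [← card_of_mem_cycleSets hk hS]
        exact expWeights.real_weightLE_le _ (by positivity)
    _ = _ := by
        rw [Finset.sum_const, nsmul_eq_mul, card_cycleSets hk, intensity, div_pow]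
        field_simp

theorem le_sum_light (hk : M.minLen ≤ k) (hx : 0 ≤ x) :
    Real.exp (-(k * x / n)) * (n.descFactorial k / (n : ℝ) ^ k * intensity M.mult k x) ≤
      ∑ S ∈ M.cycleSets n k, (expWeights (M.Edge n)).real (M.light n x S) := by
  calc _ = ∑ _ ∈ M.cycleSets n k,
          Real.exp (-(k * x / n)) * ((k * x / n) ^ k / (k.factorial : ℝ)) := by
        rw [Finset.sum_const, nsmul_eq_mul, card_cycleSets hk, intensity, div_pow]
        field_simp
    _ ≤ _ := by
        refine Finset.sum_le_sum fun _ hS => ?_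
        rw [← card_of_mem_cycleSets hk hS]
        exact expWeights.le_real_weightLE _ (by positivity)

theorem tendsto_sum_light (M : CycleModel) (hk : M.minLen ≤ k) (hx : 0 ≤ x) :
    Tendsto (fun n => ∑ S ∈ M.cycleSets n k, (expWeights (M.Edge n)).real (M.light n x S))
      atTop (𝓝 (intensity M.mult k x)) := by
  have hupper : Tendsto (fun n : ℕ => n.descFactorial k / (n : ℝ) ^ k * intensity M.mult k x)
      atTop (𝓝 (intensity M.mult k x)) := by
    simpa only [one_mul] using (tendsto_descFactorial_div_pow k).mul_const (intensity M.mult k x)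
  have hexp : Tendsto (fun n : ℕ => Real.exp (-(k * x / n))) atTop (𝓝 1) := by
    simpa only [neg_zero, Real.exp_zero] using
      (tendsto_const_div_atTop_nhds_zero_nat (k * x)).neg.rexp
  refine tendsto_of_tendsto_of_tendsto_of_le_of_le ?_ hupper (fun n => le_sum_light hk hx)
    fun n => sum_light_le hk hx
  simpa only [one_mul] using hexp.mul hupper

theorem tendsto_sum_shortSets_light (M : CycleModel) (L : ℕ) (hτ : ∀ k, 0 ≤ τ k) :
    Tendsto (fun n => ∑ S ∈ M.shortSets n L,
      (expWeights (M.Edge n)).real (M.light n (τ S.card) S)) atTop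
      (𝓝 (∑ k ∈ Finset.Icc M.minLen L, intensity M.mult k (τ k))) := by
  simp only [sum_shortSets]
  refine tendsto_finsetSum _ fun k hk => ?_
  have hmin := (Finset.mem_Icc.mp hk).1
  refine (M.tendsto_sum_light hmin (hτ k)).congr fun n => ?_
  exact Finset.sum_congr rfl fun S hS => by rw [card_of_mem_cycleSets hmin hS]

theorem real_light_inter_light_le {y : ℝ} (hK : 0 ≤ K) (hS : S.card * x ≤ K) (hT : T.card * y ≤ K) :
    (expWeights (M.Edge n)).real (M.light n x S ∩ M.light n y T) ≤ (K / n) ^ (S ∪ T).card :=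
  expWeights.real_weightLE_inter_weightLE_le S T (by positivity)
    (div_le_div_of_nonneg_right hS n.cast_nonneg) (div_le_div_of_nonneg_right hT n.cast_nonneg)

theorem real_light_le (hK : 0 ≤ K) (hS : S.card * x ≤ K) :
    (expWeights (M.Edge n)).real (M.light n x S) ≤ (K / n) ^ S.card := by
  simpa only [Set.inter_self, Finset.union_self] using real_light_inter_light_le hK hS hS

theorem real_light_inter_light_add_mul_le {y : ℝ} (hK : 0 ≤ K) (hn : K ≤ n)
    (hS : S.card * x ≤ K) (hT : T.card * y ≤ K) :
    (expWeights (M.Edge n)).real (M.light n x S ∩ M.light n y T) +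
        (expWeights (M.Edge n)).real (M.light n x S) *
          (expWeights (M.Edge n)).real (M.light n y T) ≤
      2 * (K / n) ^ (S ∪ T).card := by
  have hmul : (expWeights (M.Edge n)).real (M.light n x S) *
      (expWeights (M.Edge n)).real (M.light n y T) ≤ (K / n) ^ (S ∪ T).card := by
    calc _ ≤ (K / n) ^ S.card * (K / n) ^ T.card :=
          mul_le_mul (real_light_le hK hS) (real_light_le hK hT) measureReal_nonneg (by positivity)
      _ = (K / n) ^ (S.card + T.card) := (pow_add _ _ _).symm
      _ ≤ (K / n) ^ (S ∪ T).card := pow_le_pow_of_le_one (by positivity)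
          (div_le_one_of_le₀ hn n.cast_nonneg) (Finset.card_union_le S T)
  linarith [real_light_inter_light_le (M := M) hK hS hT]

theorem sq_real_light_le (hK : 0 ≤ K) (hn : K ≤ n) (hne : S.Nonempty) (hS : S.card * x ≤ K) :
    (expWeights (M.Edge n)).real (M.light n x S) ^ 2 ≤
      K / n * (expWeights (M.Edge n)).real (M.light n x S) := by
  rw [sq]
  refine mul_le_mul_of_nonneg_right ((real_light_le hK hS).trans ?_) measureReal_nonneg
  exact pow_le_of_le_one (by positivity) (div_le_one_of_le₀ hn n.cast_nonneg) hne.card_ne_zero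

theorem abs_real_avoid_sub_exp_le (hK : 0 ≤ K) (hn : K ≤ n) (hτ : ∀ k ≤ L, k * τ k ≤ K) :
    |(expWeights (M.Edge n)).real (M.avoid n L τ) -
      Real.exp (-∑ S ∈ M.shortSets n L, (expWeights (M.Edge n)).real (M.light n (τ S.card) S))| ≤
      K / n * ∑ S ∈ M.shortSets n L, (expWeights (M.Edge n)).real (M.light n (τ S.card) S) +
        2 * ∑ p ∈ M.overlappingPairs n L, (K / n) ^ (p.1 ∪ p.2).card := by
  have hshort {S : Finset (M.Edge n)} (hS : S ∈ M.shortSets n L) :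
      S.Nonempty ∧ S.card * τ S.card ≤ K := by
    obtain ⟨C, hmin, hmax, rfl⟩ := mem_shortSets.mp hS
    rw [← Finset.card_pos, card_edgeSet hmin]
    exact ⟨two_pos.trans_le C.two_le, hτ _ hmax⟩
  have hdep := expWeights.isDependencyRel_weightLE (E := M.Edge n)
    fun S => S.card * τ S.card / n
  refine (hdep.abs_measureReal_iInter_compl_sub_exp_le (fun S => measurableSet_light _ S)
    (M.shortSets n L)).trans (add_le_add ?_ ?_)
  · rw [Finset.mul_sum]
    exact Finset.sum_le_sum fun S hS => sq_real_light_le hK hn (hshort hS).1 (hshort hS).2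
  · rw [Finset.mul_sum]
    refine Finset.sum_le_sum fun p hp => ?_
    obtain ⟨hp1, hp2, -⟩ := Finset.mem_offDiag.mp (Finset.mem_filter.mp hp).1
    exact real_light_inter_light_add_mul_le hK hn (hshort hp1).2 (hshort hp2).2

theorem tendsto_real_avoid (M : CycleModel) (L : ℕ) (hτ : ∀ k, 0 ≤ τ k) :
    Tendsto (fun n => (expWeights (M.Edge n)).real (M.avoid n L τ)) atTop
      (𝓝 (Real.exp (-∑ k ∈ Finset.Icc M.minLen L, intensity M.mult k (τ k)))) := by
  have hsum := M.tendsto_sum_shortSets_light L hτ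
  have hterm (k : ℕ) : 0 ≤ k * τ k := mul_nonneg k.cast_nonneg (hτ k)
  let K : ℝ := ∑ k ∈ Finset.range (L + 1), k * τ k
  have hK : 0 ≤ K := Finset.sum_nonneg fun k _ => hterm k
  have hτK (k) (hk : k ≤ L) : k * τ k ≤ K :=
    Finset.single_le_sum (f := fun k : ℕ => k * τ k) (fun k _ => hterm k)
      (Finset.mem_range.mpr (Nat.lt_succ_of_le hk))
  have herror := ((tendsto_const_div_atTop_nhds_zero_nat K).mul hsum).add
    ((M.tendsto_sum_overlappingPairs_pow L hK).const_mul 2)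
  rw [zero_mul, mul_zero, add_zero] at herror
  have hdiff : Tendsto (fun n => (expWeights (M.Edge n)).real (M.avoid n L τ) -
      Real.exp (-∑ S ∈ M.shortSets n L,
        (expWeights (M.Edge n)).real (M.light n (τ S.card) S))) atTop (𝓝 0) := by
    refine squeeze_zero_norm' ?_ herror
    filter_upwards [eventually_ge_atTop ⌈K⌉₊] with n hn
    exact abs_real_avoid_sub_exp_le hK (Nat.ceil_le.mp hn) hτK
  simpa only [sub_add_cancel, zero_add] using hdiff.add hsum.neg.rexp

theorem real_exists_long_light_le (hL : M.minLen ≤ L + 1) (h0 : 0 ≤ x) (hx : x ≤ 1 / Real.exp 1) :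
    (expWeights (M.Edge n)).real
        {w | ∃ C : DirCycle n, L < C.length ∧ w ∈ M.light n x (M.edgeSet C)} ≤
      totalIntensity M.mult (L + 1) x := by
  calc _ ≤ (expWeights (M.Edge n)).real (⋃ j ∈ Finset.range n,
          ⋃ S ∈ M.cycleSets n (j + (L + 1)), M.light n x S) := by
        refine measureReal_mono ?_ (measure_ne_top _ _)
        rintro w ⟨C, hC, hw⟩
        have hlen := C.length_le
        simp only [Set.mem_iUnion]
        exact ⟨C.length - (L + 1), Finset.mem_range.mpr (by omega), M.edgeSet C,
          mem_cycleSets.mpr ⟨C, by omega, rfl⟩, hw⟩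
    _ ≤ ∑ j ∈ Finset.range n, (expWeights (M.Edge n)).real
          (⋃ S ∈ M.cycleSets n (j + (L + 1)), M.light n x S) :=
        measureReal_biUnion_finset_le _ _
    _ ≤ ∑ j ∈ Finset.range n, intensity M.mult (j + (L + 1)) x := by
        refine Finset.sum_le_sum fun j _ => (measureReal_biUnion_finset_le _ _).trans ?_
        refine (sum_light_le (by omega) h0).trans ?_
        refine mul_le_of_le_one_left (intensity_nonneg h0) (div_le_one_of_le₀ ?_ (by positivity))
        exact_mod_cast Nat.descFactorial_le_pow n _
    _ ≤ totalIntensity M.mult (L + 1) x :=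
        (summable_intensity_add M.mult_pos _ h0 hx).sum_le_tsum _ fun _ _ => intensity_nonneg h0

end CycleModel

/-! ### The length of the lightest cycle -/

theorem exists_lt_le_succ {α : Type*} [LinearOrder α] {t : ℕ → α} {N : ℕ} {x : α} (h0 : t 0 < x)
    (hN : x ≤ t N) : ∃ i < N, t i < x ∧ x ≤ t (i + 1) := by
  induction N with
  | zero => exact absurd h0 hN.not_gt
  | succ N ih =>
    by_cases hx : x ≤ t N
    · obtain ⟨i, hi, hix⟩ := ih hx
      exact ⟨i, hi.trans N.lt_succ_self, hix⟩
    · exact ⟨N, N.lt_succ_self, not_le.mp hx, hN⟩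

theorem sum_intensity_update {m l k L : ℕ} (hk : k ∈ Finset.Icc l L) (s t : ℝ) :
    ∑ j ∈ Finset.Icc l L, intensity m j (Function.update (fun _ => s) k t j) =
      partialIntensity m l L s - intensity m k s + intensity m k t := by
  have hrest : ∑ j ∈ (Finset.Icc l L).erase k,
      intensity m j (Function.update (fun _ => s) k t j) =
        ∑ j ∈ (Finset.Icc l L).erase k, intensity m j s :=
    Finset.sum_congr rfl fun j hj => by rw [Function.update_of_ne (Finset.ne_of_mem_erase hj)]
  rw [partialIntensity, ← Finset.add_sum_erase _ _ hk,
    ← Finset.add_sum_erase _ (fun j => intensity m j s) hk, hrest, Function.update_self]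
  ring

namespace CycleModel

section Definitions

variable (M : CycleModel) {n : ℕ}

/-- The mean weight of a cycle. -/
noncomputable def mean (C : DirCycle n) (w : M.Edge n → ℝ) : ℝ :=
  (∑ e ∈ M.edgeSet C, w e) / C.length

/-- `C` has the smallest mean weight of all cycles of the model. -/
def IsMin (C : DirCycle n) (w : M.Edge n → ℝ) : Prop :=
  ∀ C' : DirCycle n, M.minLen ≤ C'.length → M.mean C w ≤ M.mean C' w

/-- The event that a cycle of smallest mean weight has length `k`. -/
def minEvent (n k : ℕ) : Set (M.Edge n → ℝ) :=
  {w | ∃ C : DirCycle n, M.IsMin C w ∧ C.length = k}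

/-- The event that a cycle of smallest mean weight has length `k` and mean weight at most
`1 / (e n)`. -/
def lightMinEvent (n k : ℕ) : Set (M.Edge n → ℝ) :=
  {w | ∃ C : DirCycle n, M.IsMin C w ∧ C.length = k ∧ M.mean C w ≤ 1 / (Real.exp 1 * n)}

/-- The event that the smallest mean weight of the cycles of length `k` lies in `(t / n, t' / n]`,
while every other cycle of length at most `L` has mean weight above `s / n`. -/
def window (n L k : ℕ) (s t t' : ℝ) : Set (M.Edge n → ℝ) :=
  M.avoid n L (Function.update (fun _ => s) k t) \
    M.avoid n L (Function.update (fun _ => s) k t')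

/-- The limit of the probability of `window n L k s t t'` as `n` tends to infinity. -/
noncomputable def windowProb (L k : ℕ) (s t t' : ℝ) : ℝ :=
  Real.exp (-(partialIntensity M.mult M.minLen L s - intensity M.mult k s)) *
    (Real.exp (-intensity M.mult k t) - Real.exp (-intensity M.mult k t'))

end Definitions

variable {M : CycleModel} {n k L N : ℕ} {b s t t' x ε : ℝ} {w : M.Edge n → ℝ}

theorem minLen_ne_zero : M.minLen ≠ 0 := (two_pos.trans_le M.two_le_minLen).ne'

theorem ne_zero_of_minLen_le (hk : M.minLen ≤ k) : k ≠ 0 :=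
  (two_pos.trans_le (M.two_le_minLen.trans hk)).ne'

section Membership

theorem lightMinEvent_subset_minEvent (n k : ℕ) : M.lightMinEvent n k ⊆ M.minEvent n k :=
  fun _ ⟨C, hmin, hlen, _⟩ => ⟨C, hmin, hlen⟩

theorem mem_light_edgeSet_iff {C : DirCycle n} (hC : M.minLen ≤ C.length) :
    w ∈ M.light n x (M.edgeSet C) ↔ M.mean C w ≤ x / n := by
  have hpos : (0 : ℝ) < C.length := by exact_mod_cast two_pos.trans_le C.two_le
  rw [light, card_edgeSet hC, mean, div_le_iff₀ hpos, div_mul_eq_mul_div, mul_comm x]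
  rfl

theorem mem_avoid_iff {τ : ℕ → ℝ} :
    w ∈ M.avoid n L τ ↔ ∀ C : DirCycle n, M.minLen ≤ C.length → C.length ≤ L →
      τ C.length / n < M.mean C w := by
  simp only [avoid, Set.mem_iInter, Set.mem_compl_iff, mem_shortSets]
  constructor
  · intro h C hmin hmax
    simpa only [mem_light_edgeSet_iff hmin, card_edgeSet hmin, not_le]
      using h _ ⟨C, hmin, hmax, rfl⟩
  · rintro h S ⟨C, hmin, hmax, rfl⟩
    simpa only [mem_light_edgeSet_iff hmin, card_edgeSet hmin, not_le] using h C hmin hmax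

theorem avoid_subset_avoid (L : ℕ) {τ τ' : ℕ → ℝ} (h : τ ≤ τ') :
    M.avoid n L τ' ⊆ M.avoid n L τ := fun _ hw => mem_avoid_iff.mpr fun C hmin hmax =>
  (div_le_div_of_nonneg_right (h C.length) n.cast_nonneg).trans_lt
    (mem_avoid_iff.mp hw C hmin hmax)

theorem mem_avoid_update_iff (hk : M.minLen ≤ k) (hkL : k ≤ L) :
    w ∈ M.avoid n L (Function.update (fun _ => s) k t) ↔
      (∀ C : DirCycle n, M.minLen ≤ C.length → C.length ≤ L → C.length ≠ k →
        s / n < M.mean C w) ∧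
      ∀ C : DirCycle n, C.length = k → t / n < M.mean C w := by
  rw [mem_avoid_iff]
  constructor
  · refine fun h => ⟨fun C hmin hmax hne => ?_, fun C hC => ?_⟩
    · simpa only [Function.update_of_ne hne] using h C hmin hmax
    · simpa only [hC, Function.update_self] using h C (hC ▸ hk) (hC ▸ hkL)
  · rintro ⟨hother, hlen⟩ C hmin hmax
    by_cases hC : C.length = k
    · simpa only [hC, Function.update_self] using hlen C hC
    · simpa only [Function.update_of_ne hC] using hother C hmin hmax hC

theorem mem_window_iff (hk : M.minLen ≤ k) (hkL : k ≤ L) :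
    w ∈ M.window n L k s t t' ↔
      (∀ C : DirCycle n, M.minLen ≤ C.length → C.length ≤ L → C.length ≠ k →
        s / n < M.mean C w) ∧
      (∀ C : DirCycle n, C.length = k → t / n < M.mean C w) ∧
      ∃ C : DirCycle n, C.length = k ∧ M.mean C w ≤ t' / n := by
  rw [window, Set.mem_sdiff, mem_avoid_update_iff hk hkL, mem_avoid_update_iff hk hkL, and_assoc]
  refine and_congr_right fun hother => and_congr_right fun _ => ?_
  rw [and_iff_right hother]
  push Not
  rfl

theorem disjoint_window {s' t'' u : ℝ} (hk : M.minLen ≤ k) (hkL : k ≤ L) (h : t' ≤ t'') :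
    Disjoint (M.window n L k s t t') (M.window n L k s' t'' u) := by
  refine Set.disjoint_left.mpr fun w hw hw' => ?_
  obtain ⟨C, hC, hle⟩ := ((mem_window_iff hk hkL).mp hw).2.2
  refine (((mem_window_iff hk hkL).mp hw').2.1 C hC).not_ge (hle.trans ?_)
  exact div_le_div_of_nonneg_right h n.cast_nonneg

theorem measurableSet_window (k : ℕ) (s t t' : ℝ) : MeasurableSet (M.window n L k s t t') :=
  (measurableSet_avoid _ _).diff (measurableSet_avoid _ _)

theorem minEvent_subset {t : ℕ → ℝ} (hk : M.minLen ≤ k) (hkL : k ≤ L) (ht0 : t 0 = 0) (N : ℕ) :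
    M.minEvent n k ⊆ M.avoid n L (fun _ => t N) ∪ (M.avoid n L fun _ => 0)ᶜ ∪
      ⋃ i ∈ Finset.range N, M.window n L k (t i) (t i) (t (i + 1)) := by
  rintro w ⟨C, hmin, rfl⟩
  by_cases hN : t N / n < M.mean C w
  · exact Or.inl (Or.inl (mem_avoid_iff.mpr fun C' hC' _ => hN.trans_le (hmin C' hC')))
  by_cases hpos : 0 < M.mean C w
  · obtain ⟨i, hi, hlt, hle⟩ := exists_lt_le_succ (t := fun i => t i / n)
      (by simpa only [ht0, zero_div] using hpos) (not_lt.mp hN)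
    refine Or.inr (Set.mem_biUnion (Finset.mem_coe.mpr (Finset.mem_range.mpr hi)) ?_)
    exact (mem_window_iff hk hkL).mpr ⟨fun C' hC' _ _ => hlt.trans_le (hmin C' hC'),
      fun C' hC' => hlt.trans_le (hmin C' (hC' ▸ hk)), C, rfl, hle⟩
  · refine Or.inl (Or.inr fun h => hpos ?_)
    simpa only [zero_div] using mem_avoid_iff.mp h C hk hkL

theorem exists_forall_mean_le (w : M.Edge n → ℝ) (C : DirCycle n) :
    ∃ C₀ : DirCycle n, C₀.length = C.length ∧
      ∀ C' : DirCycle n, C'.length = C.length → M.mean C₀ w ≤ M.mean C' w := by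
  obtain ⟨k, hk, v⟩ := C
  have : Nonempty (Fin k ↪ Fin n) := ⟨v⟩
  obtain ⟨v₀, hv₀⟩ := Finite.exists_min fun v : Fin k ↪ Fin n => M.mean ⟨k, hk, v⟩ w
  refine ⟨⟨k, hk, v₀⟩, rfl, ?_⟩
  rintro ⟨_, _, v'⟩ rfl
  exact hv₀ v'

theorem window_subset_lightMinEvent_union (hk : M.minLen ≤ k) (hkL : k ≤ L)
    (hs : s ≤ 1 / Real.exp 1) :
    M.window n L k s t s ⊆ M.lightMinEvent n k ∪ {w | ∃ C : DirCycle n, L < C.length ∧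
      w ∈ M.light n (1 / Real.exp 1) (M.edgeSet C)} := by
  refine fun w hw => or_iff_not_imp_right.mpr fun hlong => ?_
  obtain ⟨hshort, -, C, rfl, hC⟩ := (mem_window_iff hk hkL).mp hw
  have hs' : s / n ≤ 1 / Real.exp 1 / n := div_le_div_of_nonneg_right hs n.cast_nonneg
  have hother (C' : DirCycle n) (hC' : M.minLen ≤ C'.length) (hne : C'.length ≠ C.length) :
      s / n < M.mean C' w := by
    rcases le_or_gt C'.length L with hle | hgt
    · exact hshort C' hC' hle hne
    · exact hs'.trans_lt (not_le.mp fun h => hlong ⟨C', hgt, (mem_light_edgeSet_iff hC').mpr h⟩)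
  obtain ⟨C₀, hlen, hC₀⟩ := exists_forall_mean_le w C
  have hC₀s : M.mean C₀ w ≤ s / n := (hC₀ C rfl).trans hC
  refine ⟨C₀, fun C' hC' => ?_, hlen, by simpa only [div_div] using hC₀s.trans hs'⟩
  by_cases hne : C'.length = C.length
  · exact hC₀ C' hne
  · exact hC₀s.trans (hother C' hC' hne).le

end Membership

section Limits

theorem tendsto_real_avoid_update (M : CycleModel) (hk : M.minLen ≤ k) (hkL : k ≤ L)
    (hs : 0 ≤ s) (ht : 0 ≤ t) :
    Tendsto (fun n => (expWeights (M.Edge n)).real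
        (M.avoid n L (Function.update (fun _ => s) k t))) atTop
      (𝓝 (Real.exp (-(partialIntensity M.mult M.minLen L s - intensity M.mult k s)) *
        Real.exp (-intensity M.mult k t))) := by
  have hnn (j : ℕ) : 0 ≤ Function.update (fun _ => s) k t j := by
    rcases eq_or_ne j k with rfl | hj
    · rwa [Function.update_self]
    · rwa [Function.update_of_ne hj]
  rw [← Real.exp_add, ← neg_add, ← sum_intensity_update (Finset.mem_Icc.mpr ⟨hk, hkL⟩)]
  exact M.tendsto_real_avoid L hnn

theorem tendsto_real_window (M : CycleModel) (hk : M.minLen ≤ k) (hkL : k ≤ L) (hs : 0 ≤ s)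
    (ht : 0 ≤ t) (htt' : t ≤ t') :
    Tendsto (fun n => (expWeights (M.Edge n)).real (M.window n L k s t t')) atTop
      (𝓝 (M.windowProb L k s t t')) := by
  have hlim := (M.tendsto_real_avoid_update hk hkL hs ht).sub
    (M.tendsto_real_avoid_update hk hkL hs (ht.trans htt'))
  rw [windowProb, mul_sub]
  refine hlim.congr fun n => (measureReal_sdiff ?_ (measurableSet_avoid _ _)).symm
  exact avoid_subset_avoid L (update_le_update_iff.mpr ⟨htt', fun _ _ => le_rfl⟩)

theorem exists_partition_abs_sum_windowProb_sub_le (M : CycleModel) (L : ℕ) (hk : k ≠ 0)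
    (hb : 0 ≤ b) (hε : 0 < ε) :
    ∃ (N : ℕ) (t : ℕ → ℝ), t 0 = 0 ∧ t N = b ∧ Monotone t ∧
      ∀ g : ℕ → ℝ, (∀ i < N, g i ∈ Set.Icc (t i) (t (i + 1))) →
        |∑ i ∈ Finset.range N, M.windowProb L k (g i) (t i) (t (i + 1)) -
          ∫ c in (0 : ℝ)..b, intensityDeriv M.mult k c *
            Real.exp (-partialIntensity M.mult M.minLen L c)| ≤ ε := by
  have hderiv (c : ℝ) : HasDerivAt (fun c => -Real.exp (-intensity M.mult k c))
      (intensityDeriv M.mult k c * Real.exp (-intensity M.mult k c)) c :=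
    ((hasDerivAt_intensity hk c).fun_neg.exp.fun_neg).congr_deriv (by ring)
  have hproduct (c : ℝ) :
      Real.exp (-(partialIntensity M.mult M.minLen L c - intensity M.mult k c)) *
          (intensityDeriv M.mult k c * Real.exp (-intensity M.mult k c)) =
        intensityDeriv M.mult k c * Real.exp (-partialIntensity M.mult M.minLen L c) := by
    rw [mul_left_comm, ← Real.exp_add, ← neg_add, sub_add_cancel]
  have hcont : Continuous fun c =>
      Real.exp (-(partialIntensity M.mult M.minLen L c - intensity M.mult k c)) :=
    ((continuous_partialIntensity _ _).sub continuous_intensity).neg.rexp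
  have hpartition := exists_partition_abs_sum_sub_integral_le hb (fun c _ => hderiv c)
    (continuous_intensityDeriv.mul continuous_intensity.neg.rexp).continuousOn
    (fun c hc => mul_nonneg (intensityDeriv_nonneg hc.1) (Real.exp_pos _).le)
    hcont.continuousOn hε
  simpa only [hproduct, neg_sub_neg, windowProb] using hpartition

theorem real_minEvent_le {t : ℕ → ℝ} (hk : M.minLen ≤ k) (hkL : k ≤ L) (ht0 : t 0 = 0) (N : ℕ) :
    (expWeights (M.Edge n)).real (M.minEvent n k) ≤
      (expWeights (M.Edge n)).real (M.avoid n L fun _ => t N) +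
        (1 - (expWeights (M.Edge n)).real (M.avoid n L fun _ => 0)) +
        ∑ i ∈ Finset.range N,
          (expWeights (M.Edge n)).real (M.window n L k (t i) (t i) (t (i + 1))) := by
  rw [← probReal_compl_eq_one_sub (measurableSet_avoid _ _)]
  refine (measureReal_mono (minEvent_subset hk hkL ht0 N) (measure_ne_top _ _)).trans ?_
  refine (measureReal_union_le _ _).trans (add_le_add (measureReal_union_le _ _) ?_)
  exact measureReal_biUnion_finset_le _ _

theorem eventually_real_minEvent_le (M : CycleModel) (hk : M.minLen ≤ k) (hkL : k ≤ L)
    (hb : 0 ≤ b) (hε : 0 < ε) :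
    ∀ᶠ n in atTop, (expWeights (M.Edge n)).real (M.minEvent n k) ≤
      (∫ c in (0 : ℝ)..b, intensityDeriv M.mult k c *
        Real.exp (-partialIntensity M.mult M.minLen L c)) +
        Real.exp (-partialIntensity M.mult M.minLen L b) + ε := by
  obtain ⟨N, t, ht0, htN, htm, hsum⟩ := M.exists_partition_abs_sum_windowProb_sub_le L
    (ne_zero_of_minLen_le hk) hb (half_pos hε)
  have ht (i : ℕ) : 0 ≤ t i := ht0 ▸ htm i.zero_le
  have hzero : Tendsto (fun n => (expWeights (M.Edge n)).real (M.avoid n L fun _ => 0)) atTop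
      (𝓝 1) := by
    have hlim := M.tendsto_real_avoid L (τ := fun _ => 0) fun _ => le_rfl
    rwa [← partialIntensity, partialIntensity_zero (Nat.pos_of_ne_zero minLen_ne_zero), neg_zero,
      Real.exp_zero] at hlim
  have hlim := ((M.tendsto_real_avoid L (τ := fun _ => t N) fun _ => ht N).add
    (hzero.const_sub 1)).add (tendsto_finsetSum (Finset.range N) fun i _ =>
      M.tendsto_real_window hk hkL (ht i) (ht i) (htm i.le_succ))
  rw [← partialIntensity, sub_self, add_zero, htN] at hlim
  have hsumle := (abs_le.mp (hsum t fun i _ => Set.left_mem_Icc.mpr (htm i.le_succ))).2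
  filter_upwards [hlim.eventually_le_const (lt_add_of_pos_right _ (half_pos hε))] with n hn
  have hle := real_minEvent_le (n := n) hk hkL ht0 N
  rw [htN] at hle
  linarith

theorem sum_real_window_le {t : ℕ → ℝ} (hk : M.minLen ≤ k) (hkL : k ≤ L) (htm : Monotone t)
    (htN : t N ≤ 1 / Real.exp 1) :
    ∑ i ∈ Finset.range N,
        (expWeights (M.Edge n)).real (M.window n L k (t (i + 1)) (t i) (t (i + 1))) ≤
      (expWeights (M.Edge n)).real (M.lightMinEvent n k) +
        totalIntensity M.mult (L + 1) (1 / Real.exp 1) := by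
  have hdisjoint : Pairwise (Function.onFun Disjoint fun i =>
      M.window n L k (t (i + 1)) (t i) (t (i + 1))) :=
    (pairwise_disjoint_on _).mpr fun i j hij => disjoint_window hk hkL (htm hij)
  rw [← measureReal_biUnion_finset (hdisjoint.set_pairwise _)
    fun i _ => measurableSet_window k _ _ _]
  refine (measureReal_mono (Set.iUnion₂_subset fun i hi => ?_) (measure_ne_top _ _)).trans
    ((measureReal_union_le _ _).trans (add_le_add_right
      (real_exists_long_light_le (hk.trans (hkL.trans L.le_succ)) (by positivity) le_rfl) _))
  exact window_subset_lightMinEvent_union hk hkL ((htm (Finset.mem_range.mp hi)).trans htN)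

theorem eventually_le_real_lightMinEvent (M : CycleModel) (hk : M.minLen ≤ k) (hkL : k ≤ L)
    (hε : 0 < ε) :
    ∀ᶠ n in atTop, (∫ c in (0 : ℝ)..(1 / Real.exp 1), intensityDeriv M.mult k c *
        Real.exp (-partialIntensity M.mult M.minLen L c)) -
        totalIntensity M.mult (L + 1) (1 / Real.exp 1) - ε ≤
      (expWeights (M.Edge n)).real (M.lightMinEvent n k) := by
  obtain ⟨N, t, ht0, htN, htm, hsum⟩ := M.exists_partition_abs_sum_windowProb_sub_le L
    (ne_zero_of_minLen_le hk) (b := 1 / Real.exp 1) (by positivity) (half_pos hε)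
  have ht (i : ℕ) : 0 ≤ t i := ht0 ▸ htm i.zero_le
  have hlim := tendsto_finsetSum (Finset.range N) fun i _ =>
    M.tendsto_real_window hk hkL (ht (i + 1)) (ht i) (htm i.le_succ)
  have hsumge := (abs_le.mp (hsum (fun i => t (i + 1)) fun i _ =>
    Set.right_mem_Icc.mpr (htm i.le_succ))).1
  filter_upwards [hlim.eventually_const_le (u := _ - ε) (by linarith)] with n hn
  linarith [sum_real_window_le (n := n) hk hkL htm htN.le]

theorem eventually_limitProb_sub_lt (M : CycleModel) (hk : M.minLen ≤ k) (hε : 0 < ε) :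
    ∀ᶠ n in atTop, limitProb M.mult M.minLen k - ε <
      (expWeights (M.Edge n)).real (M.lightMinEvent n k) := by
  obtain ⟨L, htail, hkL⟩ := (((tendsto_totalIntensity_add_one M.mult (1 / Real.exp 1))
    |>.eventually_lt_const (half_pos hε)).and (eventually_ge_atTop k)).exists
  filter_upwards [M.eventually_le_real_lightMinEvent hk hkL (half_pos (half_pos hε))] with n hn
  linarith [limitProb_le_integral M.mult_pos M.minLen L k]

theorem eventually_lt_limitProb_add (M : CycleModel) (hk : M.minLen ≤ k) (hε : 0 < ε) :
    ∀ᶠ n in atTop, (expWeights (M.Edge n)).real (M.minEvent n k) <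
      limitProb M.mult M.minLen k + ε := by
  have hk0 := ne_zero_of_minLen_le hk
  let c₀ := 1 / Real.exp 1
  have hc₀ : 0 ≤ c₀ := by positivity
  have hε4 : 0 < ε / 4 := by positivity
  obtain ⟨b, hbk, hb⟩ := ((((continuous_intensity (m := M.mult) (k := k)).tendsto c₀).mono_left
    nhdsWithin_le_nhds |>.eventually_lt_const (lt_add_of_pos_right _ hε4)).and
      (self_mem_nhdsWithin (s := Set.Ioi c₀))).exists
  have htail : Tendsto (fun L => intensity M.mult k c₀ * totalIntensity M.mult (L + 1) c₀) atTop
      (𝓝 0) := by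
    simpa only [mul_zero] using
      (tendsto_totalIntensity_add_one M.mult c₀).const_mul (intensity M.mult k c₀)
  have hexp : Tendsto (fun L => Real.exp (-partialIntensity M.mult M.minLen L b)) atTop (𝓝 0) :=
    Real.tendsto_exp_neg_atTop_nhds_zero.comp (tendsto_partialIntensity_atTop M.mult_pos _ hb)
  obtain ⟨L, ⟨hL, hLb⟩, hkL⟩ := (((htail.eventually_lt_const hε4).and
    (hexp.eventually_lt_const hε4)).and (eventually_ge_atTop k)).exists
  filter_upwards [M.eventually_real_minEvent_le hk hkL (hc₀.trans hb.le) hε4] with n hn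
  linarith [integral_le_limitProb_add M.mult_pos (hk.trans (hkL.trans L.le_succ)) hk0,
    integral_le_integral_add_sub M.mult M.minLen L hk0 hc₀ hb.le]

theorem tendsto_real_minEvent (M : CycleModel) (hk : M.minLen ≤ k) :
    Tendsto (fun n => (expWeights (M.Edge n)).real (M.minEvent n k)) atTop
      (𝓝 (limitProb M.mult M.minLen k)) := by
  refine tendsto_order.mpr ⟨fun x hx => ?_, fun x hx => ?_⟩
  · filter_upwards [M.eventually_limitProb_sub_lt hk (sub_pos.mpr hx)] with n hn
    linarith [measureReal_mono (μ := expWeights (M.Edge n)) (lightMinEvent_subset_minEvent n k)]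
  · filter_upwards [M.eventually_lt_limitProb_add hk (sub_pos.mpr hx)] with n hn
    linarith

theorem tendsto_real_lightMinEvent (M : CycleModel) (hk : M.minLen ≤ k) :
    Tendsto (fun n => (expWeights (M.Edge n)).real (M.lightMinEvent n k)) atTop
      (𝓝 (limitProb M.mult M.minLen k)) := by
  refine tendsto_order.mpr ⟨fun x hx => ?_, fun x hx => ?_⟩
  · filter_upwards [M.eventually_limitProb_sub_lt hk (sub_pos.mpr hx)] with n hn
    linarith
  · filter_upwards [M.eventually_lt_limitProb_add hk (sub_pos.mpr hx)] with n hn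
    linarith [measureReal_mono (μ := expWeights (M.Edge n)) (lightMinEvent_subset_minEvent n k)]

end Limits

end CycleModel

/-! ### The complete directed and undirected graphs -/

theorem dirModel_mean {n : ℕ} (C : DirCycle n) (w : Arc n → ℝ) :
    dirModel.mean C w = C.meanWeight w :=
  congrArg (· / (C.length : ℝ)) (Finset.sum_image (dirModel.edge_injective C C.two_le).injOn)

theorem dirModel_isMin_iff {n : ℕ} (C : DirCycle n) (w : Arc n → ℝ) :
    dirModel.IsMin C w ↔ C.IsMinMean w := by
  simp only [CycleModel.IsMin, DirCycle.IsMinMean, dirModel_mean]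
  exact forall_congr' fun C' => imp_iff_right C'.two_le

theorem dirModel_minEvent (n k : ℕ) :
    dirModel.minEvent n k = {w | ∃ C : DirCycle n, C.IsMinMean w ∧ C.length = k} :=
  Set.ext fun w => exists_congr fun C => and_congr_left' (dirModel_isMin_iff C w)

theorem dirModel_lightMinEvent (n k : ℕ) :
    dirModel.lightMinEvent n k = {w | ∃ C : DirCycle n, C.IsMinMean w ∧ C.length = k ∧
      C.meanWeight w ≤ 1 / (Real.exp 1 * n)} :=
  Set.ext fun w => exists_congr fun C => and_congr (dirModel_isMin_iff C w)
    (and_congr_right' (dirModel_mean C w ▸ Iff.rfl))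

/-- An undirected cycle, traversed in the order in which its vertices are listed. -/
def UndirCycle.toDir {n : ℕ} (C : UndirCycle n) : DirCycle n :=
  ⟨C.length, le_of_lt C.three_le, C.vert⟩

theorem UndirCycle.forall_toDir {n : ℕ} {p : DirCycle n → Prop} :
    (∀ C : UndirCycle n, p C.toDir) ↔ ∀ C : DirCycle n, 3 ≤ C.length → p C :=
  ⟨fun h C hC => h ⟨C.length, hC, C.vert⟩, fun h C => h C.toDir C.three_le⟩

theorem UndirCycle.exists_toDir {n : ℕ} {p : DirCycle n → Prop} :
    (∃ C : UndirCycle n, p C.toDir) ↔ ∃ C : DirCycle n, 3 ≤ C.length ∧ p C :=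
  ⟨fun ⟨C, hC⟩ => ⟨C.toDir, C.three_le, hC⟩, fun ⟨C, hlen, hC⟩ => ⟨⟨C.length, hlen, C.vert⟩, hC⟩⟩

theorem undirModel_mean {n : ℕ} (C : UndirCycle n) (w : UEdge n → ℝ) :
    undirModel.mean C.toDir w = C.meanWeight w :=
  congrArg (· / (C.length : ℝ))
    (Finset.sum_image (undirModel.edge_injective C.toDir C.three_le).injOn)

theorem undirModel_isMin_iff {n : ℕ} (C : UndirCycle n) (w : UEdge n → ℝ) :
    undirModel.IsMin C.toDir w ↔ C.IsMinMean w := by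
  simp only [UndirCycle.IsMinMean, ← undirModel_mean]
  exact (UndirCycle.forall_toDir (p := fun C' => undirModel.mean C.toDir w ≤
    undirModel.mean C' w)).symm

theorem undirModel_minEvent (n : ℕ) {k : ℕ} (hk : 3 ≤ k) :
    undirModel.minEvent n k = {w | ∃ C : UndirCycle n, C.IsMinMean w ∧ C.length = k} := by
  ext w
  simp only [← undirModel_isMin_iff]
  refine Iff.trans (exists_congr fun C => ?_)
    (UndirCycle.exists_toDir (p := fun C => undirModel.IsMin C w ∧ C.length = k)).symm
  exact (and_iff_right_of_imp fun h => h.2 ▸ hk).symm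

theorem undirModel_lightMinEvent (n : ℕ) {k : ℕ} (hk : 3 ≤ k) :
    undirModel.lightMinEvent n k = {w | ∃ C : UndirCycle n, C.IsMinMean w ∧ C.length = k ∧
      C.meanWeight w ≤ 1 / (Real.exp 1 * n)} := by
  ext w
  simp only [← undirModel_isMin_iff, ← undirModel_mean]
  refine Iff.trans (exists_congr fun C => ?_)
    (UndirCycle.exists_toDir (p := fun C => undirModel.IsMin C w ∧ C.length = k ∧
      undirModel.mean C w ≤ 1 / (Real.exp 1 * n))).symm
  exact (and_iff_right_of_imp fun h => h.2.1 ▸ hk).symm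

theorem limitProb_one_two_eq_pDir (k : ℕ) : limitProb 1 2 k = pDir k := by
  refine intervalIntegral.integral_congr fun c hc => ?_
  rw [Set.uIcc_of_le (by positivity)] at hc
  have hpartial : partialIntensity 1 1 1 c = c := by
    simp only [partialIntensity, intensity, Finset.Icc_self, Finset.sum_singleton, Nat.cast_one,
      Nat.factorial_one, pow_one, one_mul, div_one]
  have htotal : totalIntensity 1 2 c = treeFunction c - c := by
    rw [totalIntensity_add_one_eq_treeFunction 1 1 hc.1 hc.2, hpartial, Nat.cast_one, div_one]
  simp only [intensityDeriv, htotal, Nat.cast_one, one_mul, neg_sub, neg_add_eq_sub]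

theorem limitProb_two_three_eq_pUndir (k : ℕ) : limitProb 2 3 k = pUndir k := by
  refine intervalIntegral.integral_congr fun c hc => ?_
  rw [Set.uIcc_of_le (by positivity)] at hc
  have hpartial : partialIntensity 1 1 2 c = c + c ^ 2 := by
    rw [partialIntensity, Finset.sum_Icc_succ_top one_le_two, Finset.Icc_self,
      Finset.sum_singleton, intensity, intensity, Nat.factorial_one, Nat.factorial_two]
    push_cast
    ring
  have htotal : -totalIntensity 2 3 c = (-treeFunction c + c + c ^ 2) / 2 := by
    rw [totalIntensity_add_one_eq_treeFunction 2 2 hc.1 hc.2, hpartial, Nat.cast_ofNat]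
    ring
  simp only [intensityDeriv, htotal, Nat.cast_ofNat]

theorem mainTheorem2 :
    -- the complete directed graph
    ((∀ k : ℕ, 2 ≤ k →
        Tendsto (fun n : ℕ => (expWeights (Arc n)).real
            {w | ∃ C : DirCycle n, C.IsMinMean w ∧ C.length = k})
          atTop (𝓝 (pDir k)) ∧
        Tendsto (fun n : ℕ => (expWeights (Arc n)).real
            {w | ∃ C : DirCycle n, C.IsMinMean w ∧ C.length = k ∧
              C.meanWeight w ≤ 1 / (Real.exp 1 * n)})
          atTop (𝓝 (pDir k))) ∧
      Summable (fun j : ℕ => pDir (j + 2)) ∧ ∑' j : ℕ, pDir (j + 2) < 1) ∧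
    -- the complete undirected graph
    ((∀ k : ℕ, 3 ≤ k →
        Tendsto (fun n : ℕ => (expWeights (UEdge n)).real
            {w | ∃ C : UndirCycle n, C.IsMinMean w ∧ C.length = k})
          atTop (𝓝 (pUndir k)) ∧
        Tendsto (fun n : ℕ => (expWeights (UEdge n)).real
            {w | ∃ C : UndirCycle n, C.IsMinMean w ∧ C.length = k ∧
              C.meanWeight w ≤ 1 / (Real.exp 1 * n)})
          atTop (𝓝 (pUndir k))) ∧
      Summable (fun j : ℕ => pUndir (j + 3)) ∧ ∑' j : ℕ, pUndir (j + 3) < 1) := by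
  refine ⟨⟨fun k hk => ?_, ?_⟩, fun k hk => ?_, ?_⟩
  · simp only [← limitProb_one_two_eq_pDir, ← dirModel_minEvent, ← dirModel_lightMinEvent]
    exact ⟨dirModel.tendsto_real_minEvent hk, dirModel.tendsto_real_lightMinEvent hk⟩
  · simp only [← limitProb_one_two_eq_pDir]
    exact ⟨summable_limitProb_add one_pos two_pos, tsum_limitProb_add_lt_one one_pos two_pos⟩
  · simp only [← limitProb_two_three_eq_pUndir, ← undirModel_minEvent _ hk,
      ← undirModel_lightMinEvent _ hk]
    exact ⟨undirModel.tendsto_real_minEvent hk, undirModel.tendsto_real_lightMinEvent hk⟩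
  · simp only [← limitProb_two_three_eq_pUndir]
    exact ⟨summable_limitProb_add two_pos three_pos, tsum_limitProb_add_lt_one two_pos three_pos⟩
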